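/- **Setting.** Let $D,N,V,M,K$ be the numbers of documents, words per document, vocabulary terms, classes and topics. Let $w_{dn}$ be the observed words (jointly denoted $\mathbf W$) and $y_d\in\{1,\dots,M\}$ the document labels. Let $p_0$ be a prior probability distribution on $\mathbb R^{MK}$ and $C>0$. The variables of the topic model are $\gamma_d\in(0,\infty)^K$, points $\phi_{dn}$ of the probability simplex in $\mathbb R^K$, $\alpha\in(0,\infty)^K$, and distributions $\beta_1,\dots,\beta_K$ over the vocabulary. Put $$q(\theta,\mathbf z)=\prod_d \mathrm{Dir}(\theta_d\mid\gamma_d)\prod_n \phi_{dn}(z_{dn}),\qquad p(\theta,\mathbf z,\mathbf W\mid\alpha,\beta)=\prod_d \mathrm{Dir}(\theta_d\mid\alpha)\prod_n\theta_{d z_{dn}}\beta_{z_{dn}w_{dn}},$$ and $\mathcal L^u(q)=-E_q[\log p(\theta,\mathbf z,\mathbf W\mid\alpha,\beta)]+E_q[\log q(\theta,\mathbf z)]\in(-\infty,+\infty]$. Let $\bar Z_d=\frac1N\sum_n Z_{dn}$ (topic assignments read as indicator vectors), let $\mathbf f(y,u)\in\mathbb R^{MK}$ be the vector whose $y$-th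 block of length $K$ is $u$ and whose other blocks are $0$, and let $\Delta\mathbf f_d(y)=\mathbf f(y_d,\bar Z_d)-\mathbf f(y,\bar Z_d)$. Problem P3 (MedLDA$^c$) is $$\min_{\gamma,\phi,\alpha,\beta,q(\eta),\xi}\ \mathcal L^u(q)+KL(q(\eta)\,\|\,p_0(\eta))+C\sum_{d=1}^D\xi_d\quad\text{s.t. } E[\eta^\top\Delta\mathbf f_d(y)]\ge 1-\xi_d\ \ (\forall d,\ y\ne y_d),\quad \xi_d\ge 0\ \ (\forall d),$$ where $q(\eta)$ ranges over the probability distributions on $\mathbb R^{MK}$ for which these expectations, taken over $q(\eta)q(\theta,\mathbf z)$, exist; an optimum is a feasible point with finite, minimal objective value. The problem of minimizing over $(q(\eta),\xi)$ only, with $\gamma,\phi,\alpha,\beta$ held fixed, is called the $\eta$-step. For real $\mu_d(y)$ ($y\neq y_d$) and $v_d$, the Lagrangian is $$L=\mathcal L^u(q)+KL(q(\eta)\|p_0(\eta))+C\sum_d\xi_d-\sum_d v_d\xi_d-\sum_d\sum_{y\ne y_d}\mu_d(y)\big(E[\eta^\top\Delta\mathbf f_d(y)]+\xi_d-1\big).$$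 Put $\lambda=\lambda(\mu)=\sum_{d}\sum_{y\ne y_d}\mu_d(y)E[\Delta\mathbf f_d(y)]$ and $Z=Z(\mu)=\int p_0(\eta)\exp(\eta^\top\lambda)\,d\eta\in(0,+\infty]$. Problem D3 is $$\max_{\mu}\ -\log Z+\sum_{d}\sum_{y\ne y_d}\mu_d(y)\quad\text{s.t. } \mu_d(y)\ge0\ \ (y\ne y_d),\quad \sum_{y\ne y_d}\mu_d(y)\in[0,C]\ \ (\forall d),$$ with $-\log(+\infty)=-\infty$. Lagrange multipliers at a point are $\mu,v\ge0$ that satisfy complementary slackness and for which $(q(\eta),\xi)$ minimizes $L$ over all admissible $q(\eta)$ and all $\xi\in\mathbb R^D$, with $\gamma,\phi,\alpha,\beta$ fixed. **Statement.** 1. D3 is the Lagrange dual of the $\eta$-step, up to the constant $\mathcal L^u(q)$: if $\mathcal L^u(q)<\infty$, then for all $\mu,v$ the infimum of $L$ over $(q(\eta),\xi)$ is $\mathcal L^u(q)-\log Z+\sum_d\sum_{y\ne y_d}\mu_d(y)$ if $\sum_{y\ne y_d}\mu_d(y)+v_d=C$ for all $d$, and $-\infty$ otherwise. Moreover D3 has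 a solution. 2. At every optimum of P3, and more generally of the $\eta$-step, $\mu$ is (together with some $v$) a family of Lagrange multipliers if and only if $\mu$ solves D3, and for every solution $\mu$ of D3 one has $Z<\infty$ and $$q(\eta)=\frac1Z\,p_0(\eta)\exp\Big(\eta^\top\sum_{d=1}^D\sum_{y\ne y_d}\mu_d(y)E[\Delta\mathbf f_d(y)]\Big).$$ 3. Let $p_0=\mathcal N(0,I)$. Then the distribution $\frac1Z p_0(\eta)\exp(\eta^\top\lambda)$ is $\mathcal N(\lambda,I)$ for every $\mu$, and D3 is the problem $$\max_\mu\ -\tfrac12\Big\|\sum_{d}\sum_{y\ne y_d}\mu_d(y)E[\Delta\mathbf f_d(y)]\Big\|_2^2+\sum_{d}\sum_{y\ne y_d}\mu_d(y)$$ under the same constraints: the two objectives are equal for every $\mu$, and the two problems have the same solutions. This problem is the Lagrange dual of the multi-class SVM $$\min_{w,\xi}\ \tfrac12\|w\|_2^2+C\sum_d\xi_d\quad\text{s.t. } w^\top E[\Delta\mathbf f_d(y)]\ge1-\xi_d\ \ (\forall d,\ y\ne y_d),\quad \xi_d\ge0\ \ (\forall d),$$ that is, for all $\mu,v$ the infimum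 over $(w,\xi)$ of the Lagrangian of the SVM is the displayed objective if $\sum_{y\ne y_d}\mu_d(y)+v_d=C$ for all $d$, and $-\infty$ otherwise. For every solution $\mu$, the $q(\eta)$ of every optimum of P3 or of the $\eta$-step is $\mathcal N(\lambda,I)$; and if $\mathcal L^u(q)<\infty$, the $\eta$-step does have an optimum with $q(\eta)=\mathcal N(\lambda,I)$. -/

import Mathlib

open MeasureTheory ProbabilityTheory InformationTheory
open scoped ENNReal

noncomputable section

namespace MedLDA

/-- A labelled corpus: `D` documents with `N` words each, over a vocabulary of `V` terms, and a class
label in a set of `M` classes for every document. -/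
structure Corpus (D N V M : ℕ) where
  word : Fin D → Fin N → Fin V
  label : Fin D → Fin M

/-- The parameters of the topic model with `K` topics and of the mean-field distribution `q(θ, z)`:
`γ d` is the variational Dirichlet parameter of document `d`, `φ d n` the variational topic
distribution of its `n`-th word, `α` the Dirichlet parameter of the model, and `β k` the
distribution of topic `k` over the vocabulary. -/
structure TopicVars (D N V K : ℕ) where
  γ : Fin D → Fin K → ℝ
  φ : Fin D → Fin N → Fin K → ℝ
  α : Fin K → ℝ
  β : Fin K → Fin V → ℝ

/-- The parameters lie where the distributions they parametrize are defined. -/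
structure TopicVars.Valid {D N V K : ℕ} (t : TopicVars D N V K) : Prop where
  γ_pos : ∀ d k, 0 < t.γ d k
  φ_mem : ∀ d n, t.φ d n ∈ stdSimplex ℝ (Fin K)
  α_pos : ∀ k, 0 < t.α k
  β_mem : ∀ k, t.β k ∈ stdSimplex ℝ (Fin V)

/-- The space of the weight vector `η`, obtained by stacking one `K`-dimensional vector per class. -/
abbrev Weights (M K : ℕ) : Type := EuclideanSpace ℝ (Fin M × Fin K)

/-- The space of the hidden variables: topic proportions `θ` and topic assignments `z`. -/
abbrev Latent (D N K : ℕ) : Type := (Fin D → Fin K → ℝ) × (Fin D → Fin N → Fin K)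

/-! ### The underlying topic model -/

/-- The Dirichlet distribution, as the law of independent `Gamma(a k, 1)` variables divided by their
sum. -/
def dirichlet {K : ℕ} (a : Fin K → ℝ) : Measure (Fin K → ℝ) :=
  (Measure.pi fun k => gammaMeasure (a k) 1).map fun x k => x k / ∑ j, x j

/-- The density of the Dirichlet distribution on the probability simplex. -/
def dirichletDensity {K : ℕ} (a : Fin K → ℝ) (θ : Fin K → ℝ) : ℝ :=
  Real.Gamma (∑ k, a k) / (∏ k, Real.Gamma (a k)) * ∏ k, θ k ^ (a k - 1)

/-- The categorical distribution on `Fin K` with probabilities `p`. -/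
def categorical {K : ℕ} (p : Fin K → ℝ) : Measure (Fin K) :=
  ∑ k, ENNReal.ofReal (p k) • Measure.dirac k

/-- The factorized distribution `q(θ, z) = ∏_d q(θ_d | γ_d) ∏_n q(z_dn | φ_dn)`. -/
def qLatent {D N V K : ℕ} (t : TopicVars D N V K) : Measure (Latent D N K) :=
  (Measure.pi fun d => dirichlet (t.γ d)).prod
    (Measure.pi fun d => Measure.pi fun n => categorical (t.φ d n))

/-- The density of `q(θ, z)`. -/
def qDensity {D N V K : ℕ} (t : TopicVars D N V K) (x : Latent D N K) : ℝ :=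
  ∏ d, (dirichletDensity (t.γ d) (x.1 d) * ∏ n, t.φ d n (x.2 d n))

/-- The joint density `p(θ, z, W | α, β)` of latent Dirichlet allocation at the observed words. -/
def modelDensity {D N V M K : ℕ} (c : Corpus D N V M) (t : TopicVars D N V K)
    (x : Latent D N K) : ℝ :=
  ∏ d, (dirichletDensity t.α (x.1 d) *
    ∏ n, (x.1 d (x.2 d n) * t.β (x.2 d n) (c.word d n)))

/-- The entropy `H(q(θ, z)) = -E_q[log q(θ, z)]`. -/
def qEntropy {D N V K : ℕ} (t : TopicVars D N V K) : ℝ :=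
  -∫ x, Real.log (qDensity t x) ∂(qLatent t)

open Classical in
/-- The variational bound `L^u(q) = -E_q[log p(θ, z, W | α, β)] - H(q)`. It is `+∞` when the model
density vanishes on a set of positive `q`-probability. -/
def variationalBound {D N V M K : ℕ} (c : Corpus D N V M) (t : TopicVars D N V K) : EReal :=
  if ∀ᵐ x ∂(qLatent t), 0 < modelDensity c t x then
    ((-(∫ x, Real.log (modelDensity c t x) ∂(qLatent t)) - qEntropy t : ℝ) : EReal)
  else ⊤

/-! ### Features and expected margins -/

/-- The average topic assignment `z̄_d = (1/N) ∑_n z_dn`, where `z_dn` is read as an indicator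
vector. -/
def zbar {D N K : ℕ} (z : Fin D → Fin N → Fin K) (d : Fin D) (k : Fin K) : ℝ :=
  1 / (N : ℝ) * ∑ n, if z d n = k then 1 else 0

/-- The feature vector `f(y, u)`: its block number `y` is `u`, and all the other blocks are `0`. -/
def feature {M K : ℕ} (y : Fin M) (u : Fin K → ℝ) : Weights M K :=
  WithLp.toLp 2 fun p => if p.1 = y then u p.2 else 0

/-- `Δf_d(y) = f(y_d, z̄_d) - f(y, z̄_d)`. -/
def deltaF {D N V M K : ℕ} (c : Corpus D N V M) (d : Fin D) (y : Fin M)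
    (z : Fin D → Fin N → Fin K) : Weights M K :=
  feature (c.label d) (zbar z d) - feature y (zbar z d)

/-- `E[Δf_d(y)]`, the expectation being over `q(θ, z)`. -/
def meanDeltaF {D N V M K : ℕ} (c : Corpus D N V M) (t : TopicVars D N V K)
    (d : Fin D) (y : Fin M) : Weights M K :=
  ∫ x, deltaF c d y x.2 ∂(qLatent t)

/-- The expected margin `E[ηᵀ Δf_d(y)]`, the expectation being over `q(η) q(θ, z)`. -/
def expectedMargin {D N V M K : ℕ} (c : Corpus D N V M) (t : TopicVars D N V K)
    (q : Measure (Weights M K)) (d : Fin D) (y : Fin M) : ℝ :=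
  ∫ x, inner ℝ x.1 (deltaF c d y x.2.2) ∂(q.prod (qLatent t))

/-- `q(η)` is a probability distribution for which the expected margins exist. -/
def Admissible {D N V M K : ℕ} (c : Corpus D N V M) (t : TopicVars D N V K)
    (q : Measure (Weights M K)) : Prop :=
  IsProbabilityMeasure q ∧ ∀ d, ∀ y, y ≠ c.label d →
    Integrable (fun x : Weights M K × Latent D N K => inner ℝ x.1 (deltaF c d y x.2.2))
      (q.prod (qLatent t))

/-! ### The learning problem P3 -/

/-- All the variables of the learning problem: those of the topic model, `q(η)`, and the slacks. -/
structure Vars (D N V M K : ℕ) where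
  topic : TopicVars D N V K
  qη : Measure (Weights M K)
  ξ : Fin D → ℝ

/-- The constraints of P3. -/
structure Feasible {D N V M K : ℕ} (c : Corpus D N V M) (x : Vars D N V M K) : Prop where
  valid : x.topic.Valid
  admissible : Admissible c x.topic x.qη
  margin : ∀ d, ∀ y, y ≠ c.label d → 1 - x.ξ d ≤ expectedMargin c x.topic x.qη d y
  slack_nonneg : ∀ d, 0 ≤ x.ξ d

/-- The objective `L^u(q) + KL(q(η) ‖ p₀(η)) + C ∑_d ξ_d` of P3. -/
def objective {D N V M K : ℕ} (c : Corpus D N V M) (p₀ : Measure (Weights M K)) (C : ℝ)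
    (x : Vars D N V M K) : EReal :=
  variationalBound c x.topic + (klDiv x.qη p₀ : EReal) + ((C * ∑ d, x.ξ d : ℝ) : EReal)

/-- `x` is an optimum of P3 over all the variables. -/
def IsOptimal {D N V M K : ℕ} (c : Corpus D N V M) (p₀ : Measure (Weights M K)) (C : ℝ)
    (x : Vars D N V M K) : Prop :=
  Feasible c x ∧ objective c p₀ C x ≠ ⊤ ∧
    ∀ x', Feasible c x' → objective c p₀ C x ≤ objective c p₀ C x'

/-- `x` is an optimum of P3 over `q(η)` and `ξ`, the variables of the topic model being held fixed
(as in the corresponding step of the variational EM algorithm). -/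
def IsEtaOptimal {D N V M K : ℕ} (c : Corpus D N V M) (p₀ : Measure (Weights M K)) (C : ℝ)
    (x : Vars D N V M K) : Prop :=
  Feasible c x ∧ objective c p₀ C x ≠ ⊤ ∧
    ∀ x', Feasible c x' → x'.topic = x.topic → objective c p₀ C x ≤ objective c p₀ C x'

/-! ### The Lagrangian and the Lagrange multipliers

Families `μ_d(y)` are only used at labels `y ≠ y_d`; the entries `μ_d(y_d)` play no role. -/

/-- `∑_{y ≠ y_d} μ_d(y)`. -/
def multSum {D N V M : ℕ} (c : Corpus D N V M) (μ : Fin D → Fin M → ℝ) (d : Fin D) : ℝ :=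
  ∑ y ∈ Finset.univ.erase (c.label d), μ d y

/-- The Lagrangian of P3, with multipliers `μ` for the margin constraints and `v` for `ξ ≥ 0`.
(The constraints on the parameters of `q(θ, z)` and of the topic model are kept as constraints.) -/
def lagrangian {D N V M K : ℕ} (c : Corpus D N V M) (p₀ : Measure (Weights M K)) (C : ℝ)
    (x : Vars D N V M K) (μ : Fin D → Fin M → ℝ) (v : Fin D → ℝ) : EReal :=
  variationalBound c x.topic + (klDiv x.qη p₀ : EReal) +
    ((C * ∑ d, x.ξ d - ∑ d, v d * x.ξ d
      - ∑ d, ∑ y ∈ Finset.univ.erase (c.label d),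
          μ d y * (expectedMargin c x.topic x.qη d y + x.ξ d - 1) : ℝ) : EReal)

/-- The infimum of the Lagrangian over `q(η)` and `ξ`. -/
def dualFunction {D N V M K : ℕ} (c : Corpus D N V M) (p₀ : Measure (Weights M K)) (C : ℝ)
    (t : TopicVars D N V K) (μ : Fin D → Fin M → ℝ) (v : Fin D → ℝ) : EReal :=
  ⨅ (q : Measure (Weights M K)) (_ : Admissible c t q) (ξ : Fin D → ℝ),
    lagrangian c p₀ C ⟨t, q, ξ⟩ μ v

/-- `μ` and `v` are Lagrange multipliers of P3 at `x`: they are nonnegative, they satisfy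
complementary slackness, and `(q(η), ξ)` minimizes the Lagrangian. -/
def IsMultiplier {D N V M K : ℕ} (c : Corpus D N V M) (p₀ : Measure (Weights M K)) (C : ℝ)
    (x : Vars D N V M K) (μ : Fin D → Fin M → ℝ) (v : Fin D → ℝ) : Prop :=
  (∀ d, ∀ y, y ≠ c.label d → 0 ≤ μ d y) ∧ (∀ d, 0 ≤ v d) ∧
  (∀ d, ∀ y, y ≠ c.label d →
    μ d y * (expectedMargin c x.topic x.qη d y + x.ξ d - 1) = 0) ∧
  (∀ d, v d * x.ξ d = 0) ∧
  lagrangian c p₀ C x μ v = dualFunction c p₀ C x.topic μ v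

/-! ### The dual problem D3 -/

/-- `λ = ∑_d ∑_{y ≠ y_d} μ_d(y) E[Δf_d(y)]`. -/
def lam {D N V M K : ℕ} (c : Corpus D N V M) (t : TopicVars D N V K)
    (μ : Fin D → Fin M → ℝ) : Weights M K :=
  ∑ d, ∑ y ∈ Finset.univ.erase (c.label d), μ d y • meanDeltaF c t d y

/-- The normalizer `Z = ∫ p₀(η) exp(ηᵀ λ) dη`, possibly `+∞`. -/
def partition {M K : ℕ} (p₀ : Measure (Weights M K)) (l : Weights M K) : ℝ≥0∞ :=
  ∫⁻ η, ENNReal.ofReal (Real.exp (inner ℝ η l)) ∂p₀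

/-- The distribution `p₀(η) exp(ηᵀ λ) / Z`. -/
def tilt {M K : ℕ} (p₀ : Measure (Weights M K)) (l : Weights M K) : Measure (Weights M K) :=
  p₀.withDensity fun η => ENNReal.ofReal (Real.exp (inner ℝ η l)) / partition p₀ l

/-- The constraints of D3: nonnegative multipliers with `∑_{y ≠ y_d} μ_d(y) ∈ [0, C]`. -/
def DualFeasible {D N V M : ℕ} (c : Corpus D N V M) (C : ℝ) (μ : Fin D → Fin M → ℝ) : Prop :=
  (∀ d, ∀ y, y ≠ c.label d → 0 ≤ μ d y) ∧ ∀ d, multSum c μ d ∈ Set.Icc 0 C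

/-- The objective `-log Z + ∑_d ∑_{y ≠ y_d} μ_d(y)` of D3, which is `-∞` when `Z = +∞`. -/
def dualObjective {D N V M K : ℕ} (c : Corpus D N V M) (p₀ : Measure (Weights M K))
    (t : TopicVars D N V K) (μ : Fin D → Fin M → ℝ) : EReal :=
  -ENNReal.log (partition p₀ (lam c t μ)) + ((∑ d, multSum c μ d : ℝ) : EReal)

/-- `μ` solves D3. -/
def IsDualOptimal {D N V M K : ℕ} (c : Corpus D N V M) (p₀ : Measure (Weights M K)) (C : ℝ)
    (t : TopicVars D N V K) (μ : Fin D → Fin M → ℝ) : Prop :=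
  DualFeasible c C μ ∧
    ∀ μ', DualFeasible c C μ' → dualObjective c p₀ t μ' ≤ dualObjective c p₀ t μ

/-! ### The multi-class support vector machine -/

/-- The Lagrangian of the multi-class support vector machine
`min ½‖w‖² + C ∑_d ξ_d` subject to `wᵀ a_d(y) ≥ 1 - ξ_d` for `y ≠ y_d` and `ξ_d ≥ 0`, where
`a_d(y) = E[Δf_d(y)]`. -/
def svmLagrangian {D N V M K : ℕ} (c : Corpus D N V M) (C : ℝ) (t : TopicVars D N V K)
    (w : Weights M K) (ξ : Fin D → ℝ) (μ : Fin D → Fin M → ℝ) (v : Fin D → ℝ) : ℝ :=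
  1 / 2 * ‖w‖ ^ 2 + C * ∑ d, ξ d - ∑ d, v d * ξ d
    - ∑ d, ∑ y ∈ Finset.univ.erase (c.label d),
        μ d y * (inner ℝ w (meanDeltaF c t d y) + ξ d - 1)

/-- The dual objective `-½‖∑_d ∑_{y ≠ y_d} μ_d(y) E[Δf_d(y)]‖² + ∑_d ∑_{y ≠ y_d} μ_d(y)`. -/
def svmDualObjective {D N V M K : ℕ} (c : Corpus D N V M) (t : TopicVars D N V K)
    (μ : Fin D → Fin M → ℝ) : ℝ :=
  -(1 / 2) * ‖lam c t μ‖ ^ 2 + ∑ d, multSum c μ d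

/-- `μ` solves the dual of the multi-class support vector machine. -/
def IsSvmDualOptimal {D N V M K : ℕ} (c : Corpus D N V M) (C : ℝ) (t : TopicVars D N V K)
    (μ : Fin D → Fin M → ℝ) : Prop :=
  DualFeasible c C μ ∧
    ∀ μ', DualFeasible c C μ' → svmDualObjective c t μ' ≤ svmDualObjective c t μ

end MedLDA

end

/-! With the topic variables fixed, each slack enters the Lagrangian linearly with coefficient `C -
multSum c μ d - v d`, so its infimum is `-∞` unless all these coefficients vanish. Since `q(η)` and
`q(θ, z)` are independent, the margins see `q(θ, z)` only through `E[Δf]`, and what is left is `KL(q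
‖ p₀) - ∫ ηᵀλ dq + ∑ μ`. The Donsker-Varadhan formula evaluates its infimum over `q` as the
objective of D3 (`neg_log_partition_le`, `exists_bounded_klDiv_sub_lt`), and only the exponential
tilt can attain it (`eq_tilt_of_eq_neg_log_partition`). As an infimum of continuous functions of
`μ`, the dual objective is upper semicontinuous, hence has a maximum on the compact set of
normalized multipliers.

There is no duality gap at an optimum of the `η`-step, and no constraint qualification is needed:
for fixed `q`, the best slacks cost exactly the maximum over feasible `μ` of the penalty `∑ μ (1 -
margin)`, and a minimax theorem exchanges this maximum with the infimum over `q`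
(`IsEtaOptimal.exists_dualFeasible`). Equality throughout weak duality then yields both the tilt
form of `q(η)` and complementary slackness.

For the normal prior, the Laplace transform at complex vectors gives `Z` and identifies the tilt. An
optimum exists there because the first-order condition for the SVM dual makes `N(λ, I)` and `μ` a
saddle point. -/

/-! ### Convexity of the divergence and its behaviour under exponential tilts. -/

namespace InformationTheory

variable {α : Type*} {mα : MeasurableSpace α}

/-- The Kullback-Leibler divergence is convex in its first argument. -/
lemma klDiv_convexCombination_le (q₁ q₂ p : Measure α) [IsFiniteMeasure q₁] [IsFiniteMeasure q₂]
    [IsFiniteMeasure p] {a b : ℝ} (ha : 0 ≤ a) (hb : 0 ≤ b) (hab : a + b = 1)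
    (h₁ : q₁ ≪ p) (h₂ : q₂ ≪ p) :
    klDiv (ENNReal.ofReal a • q₁ + ENNReal.ofReal b • q₂) p ≤
      ENNReal.ofReal a * klDiv q₁ p + ENNReal.ofReal b * klDiv q₂ p := by
  have : IsFiniteMeasure (ENNReal.ofReal a • q₁) := q₁.smul_finite ENNReal.ofReal_ne_top
  have : IsFiniteMeasure (ENNReal.ofReal b • q₂) := q₂.smul_finite ENNReal.ofReal_ne_top
  have hac : ENNReal.ofReal a • q₁ + ENNReal.ofReal b • q₂ ≪ p :=
    (h₁.smul_left _).add_left (h₂.smul_left _)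
  rw [klDiv_eq_lintegral_klFun_of_ac hac, klDiv_eq_lintegral_klFun_of_ac h₁,
    klDiv_eq_lintegral_klFun_of_ac h₂, ← lintegral_const_mul _ (by fun_prop),
    ← lintegral_const_mul _ (by fun_prop), ← lintegral_add_left (by fun_prop)]
  -- Densities combine linearly, so pointwise convexity of `klFun` suffices.
  refine lintegral_mono_ae ?_
  filter_upwards [Measure.rnDeriv_add (ENNReal.ofReal a • q₁) (ENNReal.ofReal b • q₂) p,
    Measure.rnDeriv_smul_left_of_ne_top q₁ p (r := ENNReal.ofReal a) ENNReal.ofReal_ne_top,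
    Measure.rnDeriv_smul_left_of_ne_top q₂ p (r := ENNReal.ofReal b) ENNReal.ofReal_ne_top,
    q₁.rnDeriv_lt_top p, q₂.rnDeriv_lt_top p] with x h e₁ e₂ t₁ t₂
  rw [h, Pi.add_apply, e₁, e₂, Pi.smul_apply, Pi.smul_apply, smul_eq_mul, smul_eq_mul,
    ENNReal.toReal_add (ENNReal.mul_ne_top ENNReal.ofReal_ne_top t₁.ne)
      (ENNReal.mul_ne_top ENNReal.ofReal_ne_top t₂.ne), ENNReal.toReal_mul, ENNReal.toReal_mul,
    ENNReal.toReal_ofReal ha, ENNReal.toReal_ofReal hb, ← ENNReal.ofReal_mul ha,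
    ← ENNReal.ofReal_mul hb, ← ENNReal.ofReal_add
      (mul_nonneg ha (klFun_nonneg ENNReal.toReal_nonneg))
      (mul_nonneg hb (klFun_nonneg ENNReal.toReal_nonneg))]
  exact ENNReal.ofReal_le_ofReal (convexOn_klFun.2 (Set.mem_Ici.2 ENNReal.toReal_nonneg)
    (Set.mem_Ici.2 ENNReal.toReal_nonneg) ha hb hab)

/-- Gibbs' variational identity. -/
lemma toReal_klDiv_tilted (q p : Measure α) [IsProbabilityMeasure q] [IsProbabilityMeasure p]
    {f : α → ℝ} (hkl : klDiv q p ≠ ∞) (hf : Integrable f q)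
    (hexp : Integrable (fun x => Real.exp (f x)) p) :
    klDiv q (p.tilted f) ≠ ∞ ∧ (klDiv q (p.tilted f)).toReal =
      (klDiv q p).toReal - ∫ x, f x ∂q + Real.log (∫ x, Real.exp (f x) ∂p) := by
  obtain ⟨hac, hint⟩ := klDiv_ne_top_iff.1 hkl
  have := isProbabilityMeasure_tilted hexp
  have hac' : q ≪ p.tilted f := hac.trans (absolutelyContinuous_tilted hexp)
  refine ⟨klDiv_ne_top hac' (integrable_llr_tilted_right hac hf hint hexp), ?_⟩
  rw [toReal_klDiv_of_measure_eq hac' (by simp), toReal_klDiv_of_measure_eq hac (by simp),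
    integral_llr_tilted_right hac hf hexp hint]

/-- The divergence of an exponential tilt of a restriction of `p`. -/
lemma klDiv_tilted_restrict (p : Measure α) [IsProbabilityMeasure p] {s : Set α}
    (hs : MeasurableSet s) {f : α → ℝ} (hfm : Measurable f) {B : ℝ} (hB : ∀ x ∈ s, |f x| ≤ B)
    (hps : p s ≠ 0) :
    IsProbabilityMeasure ((p.restrict s).tilted f) ∧ klDiv ((p.restrict s).tilted f) p ≠ ∞ ∧
      (klDiv ((p.restrict s).tilted f) p).toReal - ∫ x, f x ∂((p.restrict s).tilted f) =
        -Real.log (∫ x in s, Real.exp (f x) ∂p) := by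
  have hexp : Integrable (fun x => Real.exp (f x)) (p.restrict s) := by
    refine Integrable.of_bound (by fun_prop) (Real.exp B) ?_
    filter_upwards [ae_restrict_mem hs] with x hx
    rw [Real.norm_eq_abs, Real.abs_exp]
    exact Real.exp_le_exp.2 ((le_abs_self _).trans (hB x hx))
  have : NeZero (p.restrict s) := ⟨by rwa [Ne, Measure.restrict_eq_zero]⟩
  have hprob := isProbabilityMeasure_tilted hexp
  have hacs : (p.restrict s).tilted f ≪ p.restrict s := tilted_absolutelyContinuous _ _
  have hac : (p.restrict s).tilted f ≪ p := hacs.trans Measure.absolutelyContinuous_restrict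
  have hfint : Integrable f ((p.restrict s).tilted f) := by
    refine Integrable.of_bound (by fun_prop) B ?_
    filter_upwards [hacs.ae_le (ae_restrict_mem hs)] with x hx
    exact hB x hx
  -- On `s` the restriction has density `1` with respect to `p`, so only the tilt contributes to the
  -- log-likelihood ratio.
  have hllr : llr ((p.restrict s).tilted f) p =ᵐ[(p.restrict s).tilted f]
      fun x => f x - Real.log (∫ x in s, Real.exp (f x) ∂p) := by
    filter_upwards [hacs.ae_le (llr_tilted_left Measure.absolutelyContinuous_restrict hexp
        hfm.aemeasurable), hacs.ae_le (ae_restrict_mem hs),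
      hac.ae_le (Measure.rnDeriv_restrict_self p hs)] with x hx hxs hr
    rw [hx, llr, hr, Set.indicator_of_mem hxs]
    simp
  have hint : Integrable (llr ((p.restrict s).tilted f) p) ((p.restrict s).tilted f) :=
    (integrable_congr hllr).2 (hfint.sub (integrable_const _))
  refine ⟨hprob, klDiv_ne_top hac hint, ?_⟩
  rw [toReal_klDiv_of_measure_eq hac (by simp), integral_congr_ae hllr,
    integral_sub hfint (integrable_const _)]
  simp

end InformationTheory

/-! ### A minimax theorem. -/

section Minimax

variable {E F : Type*} [TopologicalSpace E] [AddCommGroup E] [Module ℝ E]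
  [IsTopologicalAddGroup E] [ContinuousSMul ℝ E] [TopologicalSpace F] [AddCommGroup F] [Module ℝ F]
  [IsTopologicalAddGroup F] [ContinuousSMul ℝ F]

/-- A minimax theorem for functions that are concave and upper semicontinuous on a compact convex
set, and convex and lower semicontinuous in the other variable. -/
lemma exists_forall_le_of_forall_exists_le {X : Set E} {Y : Set F} {f : E → F → ℝ}
    (ne_X : X.Nonempty) (cX : Convex ℝ X) (kX : IsCompact X) (cY : Convex ℝ Y)
    (hx : ∀ y ∈ Y, ConcaveOn ℝ X (f · y)) (hxc : ∀ y ∈ Y, ContinuousOn (f · y) X)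
    (hy : ∀ x ∈ X, ConvexOn ℝ Y (f x)) (hyc : ∀ x ∈ X, ContinuousOn (f x) Y)
    {P : ℝ} (h : ∀ y ∈ Y, ∃ x ∈ X, P ≤ f x y) :
    ∃ x ∈ X, ∀ y ∈ Y, P ≤ f x y := by
  by_contra! hcon
  -- The sets where `f · y < P` cover the compact `X`, so finitely many `y` already defeat every
  -- `x`.
  have hfin : ∃ s : Finset Y, ∀ x ∈ X, ∃ i ∈ s, -P < -f x i := by
    rw [← LowerSemicontinuousOn.inter_biInter_preimage_Iic_eq_empty_iff_exists_finset
      (f := fun y x => -f x y) kX fun y hyY => (hxc y hyY).neg.lowerSemicontinuousOn]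
    refine Set.eq_empty_of_forall_notMem ?_
    rintro x ⟨hxX, hx'⟩
    obtain ⟨y, hyY, hlt⟩ := hcon x hxX
    simp only [Set.mem_iInter, Set.mem_preimage, Set.mem_Iic] at hx'
    linarith [hx' y hyY]
  obtain ⟨s, hs⟩ := hfin
  -- Sion's argument, applied to `-f`, merges these finitely many points into a single `y` that
  -- defeats every `x`, against `h`.
  obtain ⟨y, hyY, hlt⟩ := Sion.exists_lt_iInf_of_lt_iInf_of_finite (X := X) (Y := Y)
    (f := fun x y => -f x y) ne_X kX
    (fun y hyY => (hxc y hyY).neg.lowerSemicontinuousOn)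
    (fun y hyY => (hx y hyY).neg.quasiconvexOn) cY
    (fun x hxX => (hyc x hxX).neg.upperSemicontinuousOn)
    (fun x hxX => (hy x hxX).neg.quasiconcaveOn) cX
    (s := Subtype.val '' (s : Set Y)) (Set.toFinite _) (Subtype.coe_image_subset Y _) (t := -P)
    (fun x hxX => by
      obtain ⟨i, hi, hi'⟩ := hs x hxX
      exact ⟨i, ⟨i, hi, rfl⟩, hi'⟩)
  obtain ⟨x, hxX, hle⟩ := h y hyY
  linarith [hlt x hxX]

end Minimax

namespace MedLDA

/-! ### Exponential tilts and the Donsker-Varadhan formula. -/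

section ExponentialTilt

variable {M K : ℕ} (p : Measure (Weights M K))

lemma integrable_exp_of_partition_ne_top {l : Weights M K} (h : partition p l ≠ ∞) :
    Integrable (fun η => Real.exp (inner ℝ η l)) p :=
  (lintegral_ofReal_ne_top_iff_integrable (by fun_prop)
    (ae_of_all _ fun _ => (Real.exp_pos _).le)).1 h

lemma partition_eq_ofReal {l : Weights M K} (h : Integrable (fun η => Real.exp (inner ℝ η l)) p) :
    partition p l = ENNReal.ofReal (∫ η, Real.exp (inner ℝ η l) ∂p) :=
  (ofReal_integral_eq_lintegral_ofReal h (ae_of_all _ fun _ => (Real.exp_pos _).le)).symm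

variable [IsProbabilityMeasure p]

lemma log_partition_eq {l : Weights M K} (h : Integrable (fun η => Real.exp (inner ℝ η l)) p) :
    ENNReal.log (partition p l) = (Real.log (∫ η, Real.exp (inner ℝ η l) ∂p) : ℝ) := by
  rw [partition_eq_ofReal p h, ENNReal.log_ofReal_of_pos (integral_exp_pos h)]

lemma tilt_eq_tilted {l : Weights M K} (h : Integrable (fun η => Real.exp (inner ℝ η l)) p) :
    tilt p l = p.tilted fun η => inner ℝ η l := by
  rw [tilt, Measure.tilted, partition_eq_ofReal p h]
  congr 1
  ext η
  rw [ENNReal.ofReal_div_of_pos (integral_exp_pos h)]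

/-- The Donsker-Varadhan inequality. -/
lemma neg_log_partition_le (q : Measure (Weights M K)) [IsProbabilityMeasure q]
    {l : Weights M K} (hkl : klDiv q p ≠ ∞) (hl : Integrable (fun η => inner ℝ η l) q) :
    -ENNReal.log (partition p l) ≤ (((klDiv q p).toReal - ∫ η, inner ℝ η l ∂q : ℝ) : EReal) := by
  by_cases hZ : partition p l = ∞
  · simp [hZ]
  have hexp := integrable_exp_of_partition_ne_top p hZ
  -- The gap in the inequality is the divergence of `q` from the tilt.
  have h := (toReal_klDiv_tilted q p hkl hl hexp).2
  have h0 : 0 ≤ (klDiv q (p.tilted fun η => inner ℝ η l)).toReal := ENNReal.toReal_nonneg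
  rw [log_partition_eq p hexp, ← EReal.coe_neg, EReal.coe_le_coe_iff]
  linarith

/-- Equality in the Donsker-Varadhan inequality is attained by the exponential tilt only. -/
lemma eq_tilt_of_eq_neg_log_partition (q : Measure (Weights M K)) [IsProbabilityMeasure q]
    {l : Weights M K} (hkl : klDiv q p ≠ ∞) (hl : Integrable (fun η => inner ℝ η l) q)
    (h : -ENNReal.log (partition p l) =
      (((klDiv q p).toReal - ∫ η, inner ℝ η l ∂q : ℝ) : EReal)) :
    partition p l ≠ ∞ ∧ q = tilt p l := by
  have hZ : partition p l ≠ ∞ := by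
    intro hZ
    rw [hZ, ENNReal.log_top, EReal.neg_top] at h
    exact EReal.bot_ne_coe _ h
  refine ⟨hZ, ?_⟩
  have hexp := integrable_exp_of_partition_ne_top p hZ
  obtain ⟨hne, hkl'⟩ := toReal_klDiv_tilted q p hkl hl hexp
  have := isProbabilityMeasure_tilted hexp
  rw [log_partition_eq p hexp, ← EReal.coe_neg, EReal.coe_eq_coe_iff] at h
  rw [tilt_eq_tilted p hexp]
  refine klDiv_eq_zero_iff.1 (((ENNReal.toReal_eq_zero_iff _).1 ?_).resolve_right hne)
  linarith

/-- Gibbs' identity at the tilt itself, where the divergence on the left vanishes. Integrability of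
the exponent is assumed because a finite `Z` does not imply it. -/
lemma klDiv_tilt {l : Weights M K} (hexp : Integrable (fun η => Real.exp (inner ℝ η l)) p)
    (hl : Integrable (fun η => inner ℝ η l) (tilt p l)) :
    klDiv (tilt p l) p ≠ ∞ ∧ (((klDiv (tilt p l) p).toReal - ∫ η, inner ℝ η l ∂(tilt p l) : ℝ)
      : EReal) = -ENNReal.log (partition p l) := by
  rw [tilt_eq_tilted p hexp] at hl ⊢
  have := isProbabilityMeasure_tilted hexp
  have hac := tilted_absolutelyContinuous p fun η => inner ℝ η l
  have hllr := hac.ae_le (log_rnDeriv_tilted_left_self hexp)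
  have hkl : klDiv (p.tilted fun η => inner ℝ η l) p ≠ ∞ :=
    klDiv_ne_top hac ((integrable_congr hllr).2 (hl.sub (integrable_const _)))
  refine ⟨hkl, ?_⟩
  have h := (toReal_klDiv_tilted _ p hkl hl hexp).2
  rw [klDiv_self, ENNReal.toReal_zero] at h
  rw [log_partition_eq p hexp, ← EReal.coe_neg, EReal.coe_eq_coe_iff]
  linarith

/-- The Donsker-Varadhan bound is approached by distributions of bounded support. -/
lemma exists_bounded_klDiv_sub_lt (l : Weights M K) {r : ℝ}
    (hr : -ENNReal.log (partition p l) < r) :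
    ∃ q : Measure (Weights M K), IsProbabilityMeasure q ∧ (∃ R : ℝ, ∀ᵐ η ∂q, ‖η‖ ≤ R) ∧
      klDiv q p ≠ ∞ ∧ (klDiv q p).toReal - ∫ η, inner ℝ η l ∂q < r := by
  set g : Weights M K → ℝ≥0∞ := fun η => ENNReal.ofReal (Real.exp (inner ℝ η l)) with hg
  -- The full tilt may not exist, or may lack a first moment; tilts of `p` restricted to balls have
  -- neither defect.
  let B : ℕ → Set (Weights M K) := fun n => Metric.closedBall 0 n
  have hBmono : Monotone B := fun m n h => Metric.closedBall_subset_closedBall (by exact_mod_cast h)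
  have hU : ⋃ n, B n = Set.univ := Metric.iUnion_closedBall_nat 0
  -- Monotone convergence with values in `EReal`, which includes the case `Z = ∞`.
  have hlim : Filter.Tendsto (fun n => -ENNReal.log (∫⁻ η in B n, g η ∂p)) Filter.atTop
      (nhds (-ENNReal.log (partition p l))) := by
    have h1 : Filter.Tendsto (fun n => ∫⁻ η in B n, g η ∂p) Filter.atTop
        (nhds (partition p l)) := by
      have h2 : partition p l = ⨆ n, ∫⁻ η in B n, g η ∂p := by
        rw [← setLIntegral_iUnion_of_directed _ hBmono.directed_le, hU, setLIntegral_univ,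
          partition]
      rw [h2]
      exact tendsto_atTop_iSup fun m n h => lintegral_mono_set (hBmono h)
    exact continuous_neg.continuousAt.tendsto.comp
      (ENNReal.logHomeomorph.continuous.continuousAt.tendsto.comp h1)
  obtain ⟨n, hn⟩ := (hlim.eventually (gt_mem_nhds hr)).exists
  -- On a null ball, the truncated `-log Z` would be `+∞`, not below `r`.
  have hps : p (B n) ≠ 0 := by
    intro h0
    rw [Measure.restrict_eq_zero.2 h0, lintegral_zero_measure, ENNReal.log_zero, EReal.neg_bot]
      at hn
    exact not_top_lt hn
  have hbd : ∀ η ∈ B n, |inner ℝ η l| ≤ n * ‖l‖ := fun η hη =>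
    (abs_real_inner_le_norm _ _).trans
      (mul_le_mul_of_nonneg_right (mem_closedBall_zero_iff.1 hη) (norm_nonneg _))
  have hexp : Integrable (fun η => Real.exp (inner ℝ η l)) (p.restrict (B n)) := by
    refine Integrable.of_bound (by fun_prop) (Real.exp (n * ‖l‖)) ?_
    filter_upwards [ae_restrict_mem Metric.isClosed_closedBall.measurableSet] with x hx
    rw [Real.norm_eq_abs, Real.abs_exp]
    exact Real.exp_le_exp.2 ((le_abs_self _).trans (hbd x hx))
  have : NeZero (p.restrict (B n)) := ⟨by rwa [Ne, Measure.restrict_eq_zero]⟩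
  obtain ⟨hq, hkl, heq⟩ := klDiv_tilted_restrict p Metric.isClosed_closedBall.measurableSet
    (f := fun η => inner ℝ η l) (by fun_prop) hbd hps
  refine ⟨_, hq, ⟨n, ?_⟩, hkl, ?_⟩
  · filter_upwards [(tilted_absolutelyContinuous (p.restrict (B n)) _).ae_le
      (ae_restrict_mem Metric.isClosed_closedBall.measurableSet)] with η hη
    exact mem_closedBall_zero_iff.1 hη
  · rw [heq]
    rw [hg, ← ofReal_integral_eq_lintegral_ofReal hexp (ae_of_all _ fun _ => (Real.exp_pos _).le),
      ENNReal.log_ofReal_of_pos (integral_exp_pos hexp), ← EReal.coe_neg,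
      EReal.coe_lt_coe_iff] at hn
    exact hn

end ExponentialTilt

/-! ### Expected margins as linear functionals of `q(η)`. -/

section Margins

variable {D N V M K : ℕ} (c : Corpus D N V M) {t : TopicVars D N V K}

lemma isProbabilityMeasure_dirichlet {a : Fin K → ℝ} (ha : ∀ k, 0 < a k) :
    IsProbabilityMeasure (dirichlet a) := by
  have := fun k => isProbabilityMeasure_gammaMeasure (ha k) one_pos
  exact Measure.isProbabilityMeasure_map (Measurable.aemeasurable (by fun_prop))

lemma isProbabilityMeasure_categorical {p : Fin K → ℝ} (hp : p ∈ stdSimplex ℝ (Fin K)) :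
    IsProbabilityMeasure (categorical p) := by
  constructor
  simp [categorical, ← ENNReal.ofReal_sum_of_nonneg fun k _ => hp.1 k, hp.2]

lemma isProbabilityMeasure_qLatent (ht : t.Valid) : IsProbabilityMeasure (qLatent t) := by
  have := fun d => isProbabilityMeasure_dirichlet (ht.γ_pos d)
  have := fun d n => isProbabilityMeasure_categorical (ht.φ_mem d n)
  rw [qLatent]
  infer_instance

lemma exists_norm_deltaF_le (d : Fin D) (y : Fin M) :
    ∃ B, ∀ z : Fin D → Fin N → Fin K, ‖deltaF c d y z‖ ≤ B := by
  obtain ⟨B, hB⟩ := (Set.finite_range fun z : Fin D → Fin N → Fin K => ‖deltaF c d y z‖).bddAbove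
  exact ⟨B, fun z => hB ⟨z, rfl⟩⟩

@[fun_prop]
lemma measurable_deltaF (d : Fin D) (y : Fin M) :
    Measurable (deltaF c d y : (Fin D → Fin N → Fin K) → Weights M K) :=
  measurable_of_countable _

lemma integrable_deltaF (ht : t.Valid) (d : Fin D) (y : Fin M) :
    Integrable (fun x : Latent D N K => deltaF c d y x.2) (qLatent t) := by
  have := isProbabilityMeasure_qLatent ht
  obtain ⟨B, hB⟩ := exists_norm_deltaF_le (N := N) (K := K) c d y
  exact Integrable.of_bound (by fun_prop) B (ae_of_all _ fun x => hB x.2)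

/-- The assignments `z` take finitely many values, so `Δf` is bounded and a first moment of `η` is
enough. -/
lemma admissible_of_integrable (ht : t.Valid) {q : Measure (Weights M K)}
    [IsProbabilityMeasure q] (hq : Integrable id q) : Admissible c t q := by
  have := isProbabilityMeasure_qLatent ht
  refine ⟨inferInstance, fun d y _ => ?_⟩
  obtain ⟨B, hB⟩ := exists_norm_deltaF_le (N := N) (K := K) c d y
  refine Integrable.mono' (g := fun x => ‖x.1‖ * B) ((hq.norm.comp_fst _).mul_const B)
    (by fun_prop) (ae_of_all _ fun x => ?_)
  exact (norm_inner_le_norm _ _).trans (mul_le_mul_of_nonneg_left (hB _) (norm_nonneg _))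

lemma integrable_id_of_bounded {q : Measure (Weights M K)} [IsProbabilityMeasure q]
    {R : ℝ} (hR : ∀ᵐ η ∂q, ‖η‖ ≤ R) : Integrable id q :=
  Integrable.of_bound (by fun_prop) R hR

variable {q : Measure (Weights M K)}

variable {c} in
lemma Admissible.integrable_inner_meanDeltaF (ht : t.Valid) (hq : Admissible c t q)
    {d : Fin D} {y : Fin M} (hy : y ≠ c.label d) :
    Integrable (fun η => inner ℝ η (meanDeltaF c t d y)) q := by
  have := hq.1
  have := isProbabilityMeasure_qLatent ht
  refine (hq.2 d y hy).integral_prod_left.congr (ae_of_all _ fun η => ?_)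
  exact integral_inner (integrable_deltaF c ht d y) η

-- Fubini: `q(θ, z)` enters the margin only through `E[Δf]`. Admissibility supplies the joint
-- integrability, even when `η` has no first moment.
variable {c} in
lemma Admissible.expectedMargin_eq (ht : t.Valid) (hq : Admissible c t q)
    {d : Fin D} {y : Fin M} (hy : y ≠ c.label d) :
    expectedMargin c t q d y = ∫ η, inner ℝ η (meanDeltaF c t d y) ∂q := by
  have := hq.1
  have := isProbabilityMeasure_qLatent ht
  rw [expectedMargin, integral_prod _ (hq.2 d y hy)]
  exact integral_congr_ae (ae_of_all _ fun η => integral_inner (integrable_deltaF c ht d y) η)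

lemma inner_lam (μ : Fin D → Fin M → ℝ) (η : Weights M K) :
    inner ℝ η (lam c t μ) =
      ∑ d, ∑ y ∈ Finset.univ.erase (c.label d), μ d y * inner ℝ η (meanDeltaF c t d y) := by
  simp only [lam, inner_sum, real_inner_smul_right]

variable {c} in
lemma Admissible.integrable_inner_lam (ht : t.Valid) (hq : Admissible c t q)
    (μ : Fin D → Fin M → ℝ) : Integrable (fun η => inner ℝ η (lam c t μ)) q := by
  simp_rw [inner_lam]
  exact integrable_finsetSum _ fun d _ => integrable_finsetSum _ fun y hy =>
    (hq.integrable_inner_meanDeltaF ht (Finset.ne_of_mem_erase hy)).const_mul _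

variable {c} in
lemma Admissible.integral_inner_lam (ht : t.Valid) (hq : Admissible c t q)
    (μ : Fin D → Fin M → ℝ) : ∫ η, inner ℝ η (lam c t μ) ∂q =
      ∑ d, ∑ y ∈ Finset.univ.erase (c.label d), μ d y * expectedMargin c t q d y := by
  have hint : ∀ d, ∀ y ∈ Finset.univ.erase (c.label d),
      Integrable (fun η => μ d y * inner ℝ η (meanDeltaF c t d y)) q := fun d y hy =>
    (hq.integrable_inner_meanDeltaF ht (Finset.ne_of_mem_erase hy)).const_mul _
  simp_rw [inner_lam]
  rw [integral_finsetSum _ fun d _ => integrable_finsetSum _ (hint d)]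
  refine Finset.sum_congr rfl fun d _ => ?_
  rw [integral_finsetSum _ (hint d)]
  refine Finset.sum_congr rfl fun y hy => ?_
  rw [integral_const_mul, hq.expectedMargin_eq ht (Finset.ne_of_mem_erase hy)]

variable {c} in
lemma Admissible.convexCombination (ht : t.Valid) {q₁ q₂ : Measure (Weights M K)}
    (h₁ : Admissible c t q₁) (h₂ : Admissible c t q₂) {a b : ℝ} (ha : 0 ≤ a) (hb : 0 ≤ b)
    (hab : a + b = 1) :
    Admissible c t (ENNReal.ofReal a • q₁ + ENNReal.ofReal b • q₂) ∧
      ∀ d y, y ≠ c.label d →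
        expectedMargin c t (ENNReal.ofReal a • q₁ + ENNReal.ofReal b • q₂) d y =
          a * expectedMargin c t q₁ d y + b * expectedMargin c t q₂ d y := by
  have := h₁.1
  have := h₂.1
  have := isProbabilityMeasure_qLatent ht
  have hprod : (ENNReal.ofReal a • q₁ + ENNReal.ofReal b • q₂).prod (qLatent t) =
      ENNReal.ofReal a • q₁.prod (qLatent t) + ENNReal.ofReal b • q₂.prod (qLatent t) := by
    rw [Measure.add_prod, Measure.prod_smul_left, Measure.prod_smul_left]
  have hint₁ := fun d y hy => (h₁.2 d y hy).smul_measure (ENNReal.ofReal_ne_top (r := a))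
  have hint₂ := fun d y hy => (h₂.2 d y hy).smul_measure (ENNReal.ofReal_ne_top (r := b))
  refine ⟨⟨⟨?_⟩, fun d y hy => ?_⟩, fun d y hy => ?_⟩
  · simp [← ENNReal.ofReal_add ha hb, hab]
  · rw [hprod]
    exact (hint₁ d y hy).add_measure (hint₂ d y hy)
  · rw [expectedMargin, hprod, integral_add_measure (hint₁ d y hy) (hint₂ d y hy),
      integral_smul_measure, integral_smul_measure, ENNReal.toReal_ofReal ha,
      ENNReal.toReal_ofReal hb]
    rfl

end Margins

end MedLDA

/-! ### The Lagrangian without slacks, the dual function and solutions of D3. -/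

namespace MedLDA

variable {D N V M K : ℕ} (c : Corpus D N V M) (p₀ : Measure (Weights M K)) {t : TopicVars D N V K}

variable (t) in
/-- The Lagrangian of the `η`-step with the slack variables eliminated, and without the constant
`L^u(q)`. -/
noncomputable def marginLagrangian (q : Measure (Weights M K)) (μ : Fin D → Fin M → ℝ) : ℝ :=
  (klDiv q p₀).toReal +
    ∑ d, ∑ y ∈ Finset.univ.erase (c.label d), μ d y * (1 - expectedMargin c t q d y)

variable {p₀} in
lemma Admissible.marginLagrangian_eq {q : Measure (Weights M K)} (ht : t.Valid)
    (hq : Admissible c t q) (μ : Fin D → Fin M → ℝ) :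
    marginLagrangian c p₀ t q μ =
      (klDiv q p₀).toReal - ∫ η, inner ℝ η (lam c t μ) ∂q + ∑ d, multSum c μ d := by
  simp only [marginLagrangian, hq.integral_inner_lam ht, multSum, mul_sub, mul_one,
    Finset.sum_sub_distrib]
  ring

section DualObjective

variable [IsProbabilityMeasure p₀]

lemma dualObjective_le_marginLagrangian (ht : t.Valid) {q : Measure (Weights M K)}
    (hq : Admissible c t q) (hkl : klDiv q p₀ ≠ ∞) (μ : Fin D → Fin M → ℝ) :
    dualObjective c p₀ t μ ≤ (marginLagrangian c p₀ t q μ : EReal) := by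
  have := hq.1
  rw [hq.marginLagrangian_eq c ht, dualObjective, EReal.coe_add]
  gcongr
  exact neg_log_partition_le p₀ q hkl (hq.integrable_inner_lam ht μ)

lemma exists_marginLagrangian_lt (ht : t.Valid) (μ : Fin D → Fin M → ℝ) {r : ℝ}
    (hr : dualObjective c p₀ t μ < r) :
    ∃ q, Admissible c t q ∧ klDiv q p₀ ≠ ∞ ∧ marginLagrangian c p₀ t q μ < r := by
  have hr' : -ENNReal.log (partition p₀ (lam c t μ)) < ((r - ∑ d, multSum c μ d : ℝ) : EReal) := by
    rw [EReal.coe_sub]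
    exact EReal.lt_sub_iff_add_lt (by simp) (by simp) |>.2 hr
  obtain ⟨q, hprob, ⟨R, hR⟩, hkl, hlt⟩ := exists_bounded_klDiv_sub_lt p₀ (lam c t μ) hr'
  have hq := admissible_of_integrable c ht (integrable_id_of_bounded hR)
  exact ⟨q, hq, hkl, by rw [hq.marginLagrangian_eq c ht]; linarith⟩

lemma exists_admissible_klDiv_ne_top (ht : t.Valid) :
    ∃ q, Admissible c t q ∧ klDiv q p₀ ≠ ∞ := by
  -- At `l = 0` one has `Z = 1` and `-log Z = 0`, so any positive `r` would do.
  obtain ⟨q, hprob, ⟨R, hR⟩, hkl, -⟩ := exists_bounded_klDiv_sub_lt p₀ (0 : Weights M K) (r := 1)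
    (by simp [partition])
  exact ⟨q, admissible_of_integrable c ht (integrable_id_of_bounded hR), hkl⟩

/-- An infimum of functions affine in `μ`: this form serves both upper semicontinuity and the
minimax argument. Infinite divergences are excluded because `toReal` would turn them into `0`. -/
lemma dualObjective_eq_iInf (ht : t.Valid) (μ : Fin D → Fin M → ℝ) :
    dualObjective c p₀ t μ = ⨅ q ∈ {q | Admissible c t q ∧ klDiv q p₀ ≠ ∞},
      (marginLagrangian c p₀ t q μ : EReal) := by
  refine le_antisymm (le_iInf₂ fun q hq =>
    dualObjective_le_marginLagrangian c p₀ ht hq.1 hq.2 μ) ?_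
  refine EReal.le_of_forall_lt_iff_le.1 fun r hr => ?_
  obtain ⟨q, hq, hkl, hlt⟩ := exists_marginLagrangian_lt c p₀ ht μ hr
  exact (iInf₂_le q ⟨hq, hkl⟩).trans (EReal.coe_le_coe_iff.2 hlt.le)

end DualObjective

section DualFunction

lemma variationalBound_ne_bot : variationalBound c t ≠ ⊥ := by
  rw [variationalBound]
  split_ifs
  exacts [EReal.coe_ne_bot _, top_ne_bot]

/-- Isolates the coefficient of each slack, which decides whether the infimum over `ξ` is finite. -/
lemma lagrangian_eq (C : ℝ) {u : ℝ} (hu : variationalBound c t = u) {q : Measure (Weights M K)}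
    (hkl : klDiv q p₀ ≠ ∞) (ξ : Fin D → ℝ) (μ : Fin D → Fin M → ℝ) (v : Fin D → ℝ) :
    lagrangian c p₀ C ⟨t, q, ξ⟩ μ v =
      ((u + marginLagrangian c p₀ t q μ + ∑ d, (C - multSum c μ d - v d) * ξ d : ℝ) : EReal) := by
  have hk : (klDiv q p₀ : EReal) = (((klDiv q p₀).toReal : ℝ) : EReal) :=
    (EReal.coe_ennreal_toReal hkl).symm
  rw [lagrangian, hu, hk, ← EReal.coe_add, ← EReal.coe_add, EReal.coe_eq_coe_iff, marginLagrangian]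
  have h : ∑ d, ∑ y ∈ Finset.univ.erase (c.label d),
        μ d y * (expectedMargin c t q d y + ξ d - 1) =
      ∑ d, multSum c μ d * ξ d - ∑ d, ∑ y ∈ Finset.univ.erase (c.label d),
        μ d y * (1 - expectedMargin c t q d y) := by
    rw [← Finset.sum_sub_distrib]
    refine Finset.sum_congr rfl fun d _ => ?_
    rw [multSum, Finset.sum_mul, ← Finset.sum_sub_distrib]
    exact Finset.sum_congr rfl fun y _ => by ring
  simp only [h, sub_mul, Finset.sum_sub_distrib, Finset.mul_sum]
  ring

lemma lagrangian_eq_top (C : ℝ) (hu : variationalBound c t ≠ ⊤) {q : Measure (Weights M K)}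
    (hkl : klDiv q p₀ = ∞) (ξ : Fin D → ℝ) (μ : Fin D → Fin M → ℝ) (v : Fin D → ℝ) :
    lagrangian c p₀ C ⟨t, q, ξ⟩ μ v = ⊤ := by
  lift variationalBound c t to ℝ using ⟨hu, variationalBound_ne_bot c⟩ with u hu'
  rw [lagrangian, ← hu', hkl, EReal.coe_ennreal_top, EReal.coe_add_top, EReal.top_add_coe]

variable [IsProbabilityMeasure p₀]

lemma dualFunction_of_eq (C : ℝ) (ht : t.Valid) (hu : variationalBound c t ≠ ⊤)
    {μ : Fin D → Fin M → ℝ} {v : Fin D → ℝ} (h : ∀ d, multSum c μ d + v d = C) :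
    dualFunction c p₀ C t μ v = variationalBound c t + dualObjective c p₀ t μ := by
  lift variationalBound c t to ℝ using ⟨hu, variationalBound_ne_bot c⟩ with u hu'
  have h0 : ∀ ξ : Fin D → ℝ, ∑ d, (C - multSum c μ d - v d) * ξ d = 0 := fun ξ =>
    Finset.sum_eq_zero fun d _ => by rw [← h d]; ring
  apply le_antisymm
  · refine EReal.le_of_forall_lt_iff_le.1 fun r hr => ?_
    have hr' : dualObjective c p₀ t μ < ((r - u : ℝ) : EReal) := by
      rw [EReal.coe_sub]
      exact EReal.lt_sub_iff_add_lt (by simp) (by simp) |>.2 (by rwa [add_comm])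
    obtain ⟨q, hq, hkl, hlt⟩ := exists_marginLagrangian_lt c p₀ ht μ hr'
    refine (iInf₂_le_of_le q hq (iInf_le _ 0)).trans ?_
    rw [lagrangian_eq c p₀ C hu'.symm hkl, h0, EReal.coe_le_coe_iff]
    linarith
  · refine le_iInf₂ fun q hq => le_iInf fun ξ => ?_
    by_cases hkl : klDiv q p₀ = ∞
    · rw [lagrangian_eq_top c p₀ C (hu' ▸ hu) hkl]
      exact le_top
    · rw [lagrangian_eq c p₀ C hu'.symm hkl, h0, add_zero, EReal.coe_add]
      gcongr
      exact dualObjective_le_marginLagrangian c p₀ ht hq hkl μ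

lemma dualFunction_of_ne (C : ℝ) (ht : t.Valid) (hu : variationalBound c t ≠ ⊤)
    {μ : Fin D → Fin M → ℝ} {v : Fin D → ℝ} (h : ¬ ∀ d, multSum c μ d + v d = C) :
    dualFunction c p₀ C t μ v = ⊥ := by
  lift variationalBound c t to ℝ using ⟨hu, variationalBound_ne_bot c⟩ with u hu'
  obtain ⟨d, hd⟩ := not_forall.1 h
  have hd' : C - multSum c μ d - v d ≠ 0 := fun h0 => hd (by linarith)
  obtain ⟨q, hq, hkl⟩ := exists_admissible_klDiv_ne_top c p₀ ht
  refine (EReal.eq_bot_iff_forall_lt _).2 fun r => ?_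
  -- Moving only the slack of `d`, this value makes the Lagrangian equal to `r - 1`.
  let s := (r - 1 - u - marginLagrangian c p₀ t q μ) / (C - multSum c μ d - v d)
  refine (iInf₂_le_of_le q hq (iInf_le _ (Pi.single d s))).trans_lt ?_
  rw [lagrangian_eq c p₀ C hu'.symm hkl, EReal.coe_lt_coe_iff,
    Finset.sum_eq_single_of_mem d (Finset.mem_univ d) fun d' _ hne => by
      rw [Pi.single_eq_of_ne hne, mul_zero], Pi.single_eq_same, mul_div_cancel₀ _ hd']
  linarith

end DualFunction

section DualSolution

variable {c} {C : ℝ} {μ : Fin D → Fin M → ℝ}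

variable (c C) in
/-- The feasible multipliers, normalized to vanish at the entries that play no role. -/
def multiplierSet : Set (Fin D → Fin M → ℝ) :=
  {μ | DualFeasible c C μ ∧ ∀ d, μ d (c.label d) = 0}

@[fun_prop]
lemma continuous_multSum (d : Fin D) :
    Continuous fun μ : Fin D → Fin M → ℝ => multSum c μ d := by
  unfold multSum
  fun_prop

lemma isCompact_multiplierSet : IsCompact (multiplierSet c C) := by
  -- The bound is `max C 0` because `C` may be negative here, while the normalized entries are `0`.
  refine (isCompact_Icc (a := (0 : Fin D → Fin M → ℝ))
    (b := fun _ _ => max C 0)).of_isClosed_subset ?_ ?_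
  · have h1 : IsClosed {μ : Fin D → Fin M → ℝ | ∀ d y, y ≠ c.label d → 0 ≤ μ d y} := by
      simp only [Set.ofPred_forall]
      exact isClosed_iInter fun d => isClosed_iInter fun y => isClosed_iInter fun _ =>
        isClosed_le continuous_const (by fun_prop)
    have h2 : IsClosed {μ : Fin D → Fin M → ℝ | ∀ d, multSum c μ d ∈ Set.Icc 0 C} := by
      simp only [Set.ofPred_forall]
      exact isClosed_iInter fun d => isClosed_Icc.preimage (continuous_multSum d)
    have h3 : IsClosed {μ : Fin D → Fin M → ℝ | ∀ d, μ d (c.label d) = 0} := by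
      simp only [Set.ofPred_forall]
      exact isClosed_iInter fun d => isClosed_eq (by fun_prop) continuous_const
    exact (h1.inter h2).inter h3
  · rintro μ ⟨⟨h1, h2⟩, h3⟩
    have h0 : ∀ d y, 0 ≤ μ d y := fun d y => by
      by_cases hy : y = c.label d
      · rw [hy, h3]
      · exact h1 d y hy
    refine ⟨h0, fun d y => ?_⟩
    by_cases hy : y = c.label d
    · rw [hy, h3]
      exact le_max_right _ _
    · exact ((Finset.single_le_sum (fun y _ => h0 d y)
        (Finset.mem_erase.2 ⟨hy, Finset.mem_univ y⟩)).trans (h2 d).2).trans (le_max_left _ _)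

lemma multSum_convexCombination (μ ν : Fin D → Fin M → ℝ) (a b : ℝ) (d : Fin D) :
    multSum c (a • μ + b • ν) d = a * multSum c μ d + b * multSum c ν d := by
  simp only [multSum, Finset.mul_sum, ← Finset.sum_add_distrib]
  rfl

lemma lam_convexCombination (μ ν : Fin D → Fin M → ℝ) (a b : ℝ) :
    lam c t (a • μ + b • ν) = a • lam c t μ + b • lam c t ν := by
  simp only [lam, Finset.smul_sum, ← Finset.sum_add_distrib, smul_smul, ← add_smul]
  rfl

lemma convex_dualFeasible : Convex ℝ {μ : Fin D → Fin M → ℝ | DualFeasible c C μ} := by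
  rintro μ ⟨h1, h2⟩ ν ⟨k1, k2⟩ a b ha hb hab
  refine ⟨fun d y hy => add_nonneg (mul_nonneg ha (h1 d y hy)) (mul_nonneg hb (k1 d y hy)),
    fun d => ?_⟩
  rw [multSum_convexCombination]
  exact convex_Icc 0 C (h2 d) (k2 d) ha hb hab

lemma convex_multiplierSet : Convex ℝ (multiplierSet c C) := by
  rintro μ ⟨h, h0⟩ ν ⟨k, k0⟩ a b ha hb hab
  exact ⟨convex_dualFeasible h k ha hb hab, fun d => by simp [h0, k0]⟩

lemma multiplierSet_nonempty (hC : 0 ≤ C) : (multiplierSet c C).Nonempty :=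
  ⟨0, ⟨fun _ _ _ => le_rfl, fun d => by simp [multSum, hC]⟩, fun _ => rfl⟩

lemma multSum_congr {ν : Fin D → Fin M → ℝ} (h : ∀ d, ∀ y, y ≠ c.label d → μ d y = ν d y)
    (d : Fin D) : multSum c μ d = multSum c ν d :=
  Finset.sum_congr rfl fun y hy => h d y (Finset.ne_of_mem_erase hy)

lemma lam_congr {ν : Fin D → Fin M → ℝ} (h : ∀ d, ∀ y, y ≠ c.label d → μ d y = ν d y) :
    lam c t μ = lam c t ν :=
  Finset.sum_congr rfl fun d _ => Finset.sum_congr rfl fun y hy => by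
    rw [h d y (Finset.ne_of_mem_erase hy)]

lemma DualFeasible.exists_mem_multiplierSet (h : DualFeasible c C μ) :
    ∃ ν ∈ multiplierSet c C, ∀ d, ∀ y, y ≠ c.label d → μ d y = ν d y := by
  let ν : Fin D → Fin M → ℝ := fun d y => if y = c.label d then 0 else μ d y
  have hν : ∀ d, ∀ y, y ≠ c.label d → μ d y = ν d y := fun d y hy => by simp [ν, hy]
  exact ⟨ν, ⟨⟨fun d y hy => hν d y hy ▸ h.1 d y hy, fun d => multSum_congr hν d ▸ h.2 d⟩,
    fun d => by simp [ν]⟩, hν⟩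

lemma dualObjective_congr {ν : Fin D → Fin M → ℝ}
    (h : ∀ d, ∀ y, y ≠ c.label d → μ d y = ν d y) :
    dualObjective c p₀ t μ = dualObjective c p₀ t ν := by
  simp only [dualObjective, lam_congr h, multSum_congr h]

@[fun_prop]
lemma continuous_marginLagrangian (q : Measure (Weights M K)) :
    Continuous (marginLagrangian c p₀ t q) := by
  unfold marginLagrangian
  fun_prop

variable [IsProbabilityMeasure p₀]

/-- The dual objective may take the value `-∞`, so semicontinuity in `EReal` replaces continuity.
The maximum over normalized multipliers is global, as the entries at the true labels do not matter.
-/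
lemma exists_isDualOptimal (hC : 0 ≤ C) (ht : t.Valid) : ∃ μ, IsDualOptimal c p₀ C t μ := by
  have husc : UpperSemicontinuous (dualObjective c p₀ t) := by
    rw [funext (dualObjective_eq_iInf c p₀ ht)]
    exact upperSemicontinuous_biInf fun q _ =>
      (continuous_coe_real_ereal.comp (continuous_marginLagrangian p₀ q)).upperSemicontinuous
  obtain ⟨μ, hμ, hmax⟩ := (husc.upperSemicontinuousOn _).exists_isMaxOn
    (multiplierSet_nonempty (c := c) hC) isCompact_multiplierSet
  refine ⟨μ, hμ.1, fun μ' hμ' => ?_⟩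
  obtain ⟨ν, hν, hν'⟩ := hμ'.exists_mem_multiplierSet
  rw [dualObjective_congr p₀ hν']
  exact hmax hν

end DualSolution

end MedLDA

/-! ### Strong duality for the `η`-step and its consequences. -/

namespace MedLDA

variable {D N V M K : ℕ} {c : Corpus D N V M} {p₀ : Measure (Weights M K)}
  {t : TopicVars D N V K} {C : ℝ} {μ : Fin D → Fin M → ℝ}

/-- The optimal slack of a document, and multipliers that attain it. -/
lemma exists_hinge_weights (hC : 0 ≤ C) (y₀ : Fin M) (g : Fin M → ℝ) :
    ∃ (ξ : ℝ) (w : Fin M → ℝ), 0 ≤ ξ ∧ (∀ y, y ≠ y₀ → g y ≤ ξ) ∧ (∀ y, 0 ≤ w y) ∧ w y₀ = 0 ∧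
      ∑ y ∈ Finset.univ.erase y₀, w y ≤ C ∧
      ∑ y ∈ Finset.univ.erase y₀, w y * g y = C * ξ := by
  -- If some `g y` is positive, the slack is the maximum and all the weight `C` sits at a maximizer;
  -- otherwise slack and weights vanish.
  by_cases h : ∃ y, y ≠ y₀ ∧ 0 < g y
  · obtain ⟨y', hy', hpos⟩ := h
    obtain ⟨m, hm, hmax⟩ := (Finset.univ.erase y₀).exists_max_image g
      ⟨y', Finset.mem_erase.2 ⟨hy', Finset.mem_univ _⟩⟩
    refine ⟨g m, Pi.single m C,
      hpos.le.trans (hmax y' (Finset.mem_erase.2 ⟨hy', Finset.mem_univ _⟩)),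
      fun y hy => hmax y (Finset.mem_erase.2 ⟨hy, Finset.mem_univ _⟩),
      fun y => (Pi.single_nonneg.2 hC : (0 : Fin M → ℝ) ≤ _) y,
      Pi.single_eq_of_ne (Finset.ne_of_mem_erase hm).symm _, ?_, ?_⟩
    · rw [Finset.sum_eq_single_of_mem m hm fun y _ hne => Pi.single_eq_of_ne hne _,
        Pi.single_eq_same]
    · rw [Finset.sum_eq_single_of_mem m hm fun y _ hne => by
        rw [Pi.single_eq_of_ne hne, zero_mul], Pi.single_eq_same]
  · push Not at h
    exact ⟨0, 0, le_rfl, h, fun _ => le_rfl, rfl, by simpa using hC, by simp⟩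

/-- The optimal slack variables, and multipliers that attain them. -/
lemma exists_slack_and_multipliers (hC : 0 ≤ C) (g : Fin D → Fin M → ℝ) :
    ∃ (ξ : Fin D → ℝ), ∃ ν ∈ multiplierSet c C, (∀ d, 0 ≤ ξ d) ∧
      (∀ d, ∀ y, y ≠ c.label d → g d y ≤ ξ d) ∧
      ∑ d, ∑ y ∈ Finset.univ.erase (c.label d), ν d y * g d y = C * ∑ d, ξ d := by
  choose ξ w h1 h2 h3 h4 h5 h6 using fun d => exists_hinge_weights hC (c.label d) (g d)
  refine ⟨ξ, w, ⟨⟨fun d y _ => h3 d y, fun d => ⟨Finset.sum_nonneg fun y _ => h3 d y, h5 d⟩⟩, h4⟩,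
    h1, h2, ?_⟩
  rw [Finset.mul_sum]
  exact Finset.sum_congr rfl fun d _ => h6 d

lemma objective_eq {u : ℝ} (hu : variationalBound c t = u) {q : Measure (Weights M K)}
    (hkl : klDiv q p₀ ≠ ∞) (ξ : Fin D → ℝ) :
    objective c p₀ C ⟨t, q, ξ⟩ = ((u + ((klDiv q p₀).toReal + C * ∑ d, ξ d) : ℝ) : EReal) := by
  rw [objective, hu, ← EReal.coe_ennreal_toReal hkl, ← EReal.coe_add, ← EReal.coe_add, add_assoc]

lemma variationalBound_ne_top_of_objective {x : Vars D N V M K} (h : objective c p₀ C x ≠ ⊤) :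
    variationalBound c x.topic ≠ ⊤ ∧ klDiv x.qη p₀ ≠ ∞ := by
  constructor
  · intro hu
    refine h ?_
    rw [objective, hu, EReal.top_add_of_ne_bot (EReal.coe_ennreal_ne_bot _), EReal.top_add_coe]
  · intro hk
    refine h ?_
    rw [objective, hk, EReal.coe_ennreal_top,
      EReal.add_top_of_ne_bot (variationalBound_ne_bot c), EReal.top_add_coe]

lemma IsOptimal.isEtaOptimal {x : Vars D N V M K} (h : IsOptimal c p₀ C x) :
    IsEtaOptimal c p₀ C x :=
  ⟨h.1, h.2.1, fun x' hx' _ => h.2.2 x' hx'⟩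

/-- Weak duality, in terms of the Lagrangian with the slack variables eliminated. -/
lemma Feasible.marginLagrangian_le {x : Vars D N V M K} (hx : Feasible c x)
    (hμ : DualFeasible c C μ) :
    marginLagrangian c p₀ x.topic x.qη μ ≤ (klDiv x.qη p₀).toReal + C * ∑ d, x.ξ d := by
  rw [marginLagrangian, Finset.mul_sum]
  gcongr with d
  calc ∑ y ∈ Finset.univ.erase (c.label d), μ d y * (1 - expectedMargin c x.topic x.qη d y)
      ≤ ∑ y ∈ Finset.univ.erase (c.label d), μ d y * x.ξ d := by
        refine Finset.sum_le_sum fun y hy => mul_le_mul_of_nonneg_left ?_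
          (hμ.1 d y (Finset.ne_of_mem_erase hy))
        linarith [hx.margin d y (Finset.ne_of_mem_erase hy)]
    _ = multSum c μ d * x.ξ d := by rw [multSum, Finset.sum_mul]
    _ ≤ C * x.ξ d := mul_le_mul_of_nonneg_right (hμ.2 d).2 (hx.slack_nonneg d)

lemma IsEtaOptimal.le_of_feasible {x : Vars D N V M K} (hx : IsEtaOptimal c p₀ C x)
    {q : Measure (Weights M K)} {ξ : Fin D → ℝ} (hf : Feasible c ⟨x.topic, q, ξ⟩)
    (hkl : klDiv q p₀ ≠ ∞) :
    (klDiv x.qη p₀).toReal + C * ∑ d, x.ξ d ≤ (klDiv q p₀).toReal + C * ∑ d, ξ d := by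
  obtain ⟨hu, hk⟩ := variationalBound_ne_top_of_objective hx.2.1
  lift variationalBound c x.topic to ℝ using ⟨hu, variationalBound_ne_bot c⟩ with u hu'
  have h := hx.2.2 _ hf rfl
  rw [objective_eq hu'.symm hkl] at h
  have h' := objective_eq (C := C) hu'.symm hk x.ξ
  rw [show (⟨x.topic, x.qη, x.ξ⟩ : Vars D N V M K) = x from rfl] at h'
  rw [h', EReal.coe_le_coe_iff] at h
  linarith

variable [IsProbabilityMeasure p₀]

lemma Feasible.dualObjective_le {x : Vars D N V M K} (hx : Feasible c x)
    (hkl : klDiv x.qη p₀ ≠ ∞) (hμ : DualFeasible c C μ) :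
    dualObjective c p₀ x.topic μ ≤
      (((klDiv x.qη p₀).toReal + C * ∑ d, x.ξ d : ℝ) : EReal) :=
  (dualObjective_le_marginLagrangian c p₀ hx.valid hx.admissible hkl μ).trans
    (EReal.coe_le_coe_iff.2 (hx.marginLagrangian_le hμ))

/-- Strong duality for the `η`-step. -/
lemma IsEtaOptimal.exists_dualFeasible {x : Vars D N V M K} (hC : 0 ≤ C)
    (hx : IsEtaOptimal c p₀ C x) :
    ∃ μ, DualFeasible c C μ ∧ (((klDiv x.qη p₀).toReal + C * ∑ d, x.ξ d : ℝ) : EReal) ≤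
      dualObjective c p₀ x.topic μ := by
  have ht := hx.1.valid
  -- Each `q` is represented by its margin deficits and an upper bound for its divergence. This puts
  -- the minimax problem in finite dimension; the bound is an inequality because the divergence is
  -- convex in `q`, not affine.
  let Y : Set ((Fin D → Fin M → ℝ) × ℝ) :=
    {s | ∃ q, Admissible c x.topic q ∧ klDiv q p₀ ≠ ∞ ∧ (klDiv q p₀).toReal ≤ s.2 ∧
      ∀ d y, y ≠ c.label d → s.1 d y = 1 - expectedMargin c x.topic q d y}
  have cY : Convex ℝ Y := by
    rintro s ⟨q₁, hq₁, hk₁, hl₁, hm₁⟩ s' ⟨q₂, hq₂, hk₂, hl₂, hm₂⟩ a b ha hb hab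
    have := hq₁.1
    have := hq₂.1
    obtain ⟨hq, hm⟩ := hq₁.convexCombination ht hq₂ ha hb hab
    have hle := klDiv_convexCombination_le q₁ q₂ p₀ ha hb hab (klDiv_ne_top_iff.1 hk₁).1
      (klDiv_ne_top_iff.1 hk₂).1
    have ht₁ := ENNReal.mul_ne_top (ENNReal.ofReal_ne_top (r := a)) hk₁
    have ht₂ := ENNReal.mul_ne_top (ENNReal.ofReal_ne_top (r := b)) hk₂
    refine ⟨_, hq, ne_top_of_le_ne_top (ENNReal.add_ne_top.2 ⟨ht₁, ht₂⟩) hle, ?_, ?_⟩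
    · refine (ENNReal.toReal_mono (ENNReal.add_ne_top.2 ⟨ht₁, ht₂⟩) hle).trans ?_
      rw [ENNReal.toReal_add ht₁ ht₂, ENNReal.toReal_mul, ENNReal.toReal_mul,
        ENNReal.toReal_ofReal ha, ENNReal.toReal_ofReal hb]
      exact add_le_add (mul_le_mul_of_nonneg_left hl₁ ha) (mul_le_mul_of_nonneg_left hl₂ hb)
    · intro d y hy
      simp only [Prod.fst_add, Prod.smul_fst, Pi.add_apply, Pi.smul_apply, smul_eq_mul,
        hm₁ d y hy, hm₂ d y hy, hm d y hy]
      linear_combination hab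
  -- `marginLagrangian` in these coordinates, continuous and affine in each variable.
  let f : (Fin D → Fin M → ℝ) → (Fin D → Fin M → ℝ) × ℝ → ℝ := fun μ s =>
    s.2 + ∑ d, ∑ y ∈ Finset.univ.erase (c.label d), μ d y * s.1 d y
  have f_left : ∀ s μ ν (a b : ℝ), a + b = 1 → f (a • μ + b • ν) s = a * f μ s + b * f ν s := by
    intro s μ ν a b hab
    simp only [f, Pi.add_apply, Pi.smul_apply, smul_eq_mul, add_mul, Finset.sum_add_distrib,
      mul_assoc, ← Finset.mul_sum]
    linear_combination (-s.2) * hab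
  have f_right : ∀ μ s s' (a b : ℝ), f μ (a • s + b • s') = a * f μ s + b * f μ s' := by
    intro μ s s' a b
    simp only [f, Prod.snd_add, Prod.smul_snd, Prod.fst_add, Prod.smul_fst, Pi.add_apply,
      Pi.smul_apply, smul_eq_mul, mul_add, Finset.sum_add_distrib, mul_left_comm _ a,
      mul_left_comm _ b, ← Finset.mul_sum]
    ring
  obtain ⟨μ, hμ, hle⟩ := exists_forall_le_of_forall_exists_le (f := f)
    (P := (klDiv x.qη p₀).toReal + C * ∑ d, x.ξ d)
    (multiplierSet_nonempty (c := c) hC) convex_multiplierSet isCompact_multiplierSet cY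
    (fun s _ => ⟨convex_multiplierSet, fun μ _ ν _ a b _ _ hab => (f_left s μ ν a b hab).ge⟩)
    (fun s _ => by fun_prop)
    (fun μ _ => ⟨cY, fun s _ s' _ a b _ _ _ => (f_right μ s s' a b).le⟩)
    (fun μ _ => by fun_prop)
    (by
      rintro s ⟨q, hq, hkl, hl, hm⟩
      -- With the optimal slacks for `q` and the multipliers attaining them, the penalty is `C * ∑
      -- d, ξ d`, so optimality of `x` gives the bound.
      obtain ⟨ξ, ν, hν, hξ, hg, heq⟩ := exists_slack_and_multipliers (c := c) hC s.1
      refine ⟨ν, hν, ?_⟩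
      have hf : Feasible c ⟨x.topic, q, ξ⟩ :=
        ⟨ht, hq, fun d y hy => by
          have := hg d y hy
          rw [hm d y hy] at this
          simp only
          linarith, hξ⟩
      have := hx.le_of_feasible hf hkl
      simp only [f, heq]
      linarith)
  refine ⟨μ, hμ.1, ?_⟩
  rw [dualObjective_eq_iInf c p₀ ht]
  refine le_iInf₂ fun q hq => EReal.coe_le_coe_iff.2 ?_
  exact hle (fun d y => 1 - expectedMargin c x.topic q d y, (klDiv q p₀).toReal)
    ⟨q, hq.1, hq.2, le_rfl, fun _ _ _ => rfl⟩

/-- With no duality gap, solving D3 means attaining the primal value. -/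
lemma IsEtaOptimal.isDualOptimal_iff {x : Vars D N V M K} (hC : 0 ≤ C)
    (hx : IsEtaOptimal c p₀ C x) :
    IsDualOptimal c p₀ C x.topic μ ↔ DualFeasible c C μ ∧
      dualObjective c p₀ x.topic μ =
        (((klDiv x.qη p₀).toReal + C * ∑ d, x.ξ d : ℝ) : EReal) := by
  have hkl := (variationalBound_ne_top_of_objective hx.2.1).2
  constructor
  · rintro ⟨hμ, hmax⟩
    obtain ⟨μ', hμ', hle⟩ := hx.exists_dualFeasible hC
    exact ⟨hμ, le_antisymm (hx.1.dualObjective_le hkl hμ) (hle.trans (hmax μ' hμ'))⟩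
  · rintro ⟨hμ, heq⟩
    exact ⟨hμ, fun μ' hμ' => heq ▸ hx.1.dualObjective_le hkl hμ'⟩

/-- The value lies between the dual objective at `μ` and the primal value, which coincide. -/
lemma IsEtaOptimal.marginLagrangian_eq {x : Vars D N V M K} (hC : 0 ≤ C)
    (hx : IsEtaOptimal c p₀ C x) (hμ : IsDualOptimal c p₀ C x.topic μ) :
    marginLagrangian c p₀ x.topic x.qη μ = (klDiv x.qη p₀).toReal + C * ∑ d, x.ξ d := by
  obtain ⟨hf, heq⟩ := (hx.isDualOptimal_iff hC).1 hμ
  refine le_antisymm (hx.1.marginLagrangian_le hf) ?_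
  rw [← EReal.coe_le_coe_iff, ← heq]
  exact dualObjective_le_marginLagrangian c p₀ hx.1.valid hx.1.admissible
    (variationalBound_ne_top_of_objective hx.2.1).2 μ

/-- The absence of a gap forces the equality case of the Donsker-Varadhan inequality. -/
lemma IsEtaOptimal.eq_tilt {x : Vars D N V M K} (hC : 0 ≤ C)
    (hx : IsEtaOptimal c p₀ C x) (hμ : IsDualOptimal c p₀ C x.topic μ) :
    partition p₀ (lam c x.topic μ) ≠ ∞ ∧ x.qη = tilt p₀ (lam c x.topic μ) := by
  have := hx.1.admissible.1
  have heq := ((hx.isDualOptimal_iff hC).1 hμ).2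
  rw [← hx.marginLagrangian_eq hC hμ, hx.1.admissible.marginLagrangian_eq c hx.1.valid,
    EReal.coe_add, dualObjective] at heq
  exact eq_tilt_of_eq_neg_log_partition p₀ x.qη (variationalBound_ne_top_of_objective hx.2.1).2
    (hx.1.admissible.integrable_inner_lam hx.1.valid μ) ((EReal.addLECancellable_coe _).inj_left.1 heq)

/-- Complementary slackness turns the Lagrangian at `x` into the primal value; as this is finite,
`v` must be `C - multSum c μ`, and the minimum over `q(η)` and `ξ` is then the dual objective.
Conversely, this `v` works because a zero gap leaves no room for positive slackness products. -/
lemma IsEtaOptimal.exists_isMultiplier_iff {x : Vars D N V M K} (hC : 0 ≤ C)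
    (hx : IsEtaOptimal c p₀ C x) :
    (∃ v, IsMultiplier c p₀ C x μ v) ↔ IsDualOptimal c p₀ C x.topic μ := by
  obtain ⟨hu, hkl⟩ := variationalBound_ne_top_of_objective hx.2.1
  have ht := hx.1.valid
  have hlag : ∀ v, lagrangian c p₀ C x μ v = variationalBound c x.topic +
      ((((klDiv x.qη p₀).toReal + C * ∑ d, x.ξ d) - ∑ d, v d * x.ξ d
        - ∑ d, ∑ y ∈ Finset.univ.erase (c.label d),
          μ d y * (expectedMargin c x.topic x.qη d y + x.ξ d - 1) : ℝ) : EReal) := by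
    intro v
    rw [lagrangian, ← EReal.coe_ennreal_toReal hkl, add_assoc, ← EReal.coe_add]
    congr 2
    ring
  have hcancel : ∀ {a b : EReal}, variationalBound c x.topic + a = variationalBound c x.topic + b →
      a = b := by
    lift variationalBound c x.topic to ℝ using ⟨hu, variationalBound_ne_bot c⟩ with u hu'
    exact fun h => (EReal.addLECancellable_coe u).inj.1 h
  constructor
  · rintro ⟨v, h1, h2, h3, h4, h5⟩
    have hs1 : ∑ d, v d * x.ξ d = 0 := Finset.sum_eq_zero fun d _ => h4 d
    have hs2 : ∑ d, ∑ y ∈ Finset.univ.erase (c.label d),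
        μ d y * (expectedMargin c x.topic x.qη d y + x.ξ d - 1) = 0 :=
      Finset.sum_eq_zero fun d _ => Finset.sum_eq_zero fun y hy =>
        h3 d y (Finset.ne_of_mem_erase hy)
    rw [hlag, hs1, hs2, sub_zero, sub_zero] at h5
    by_cases hv : ∀ d, multSum c μ d + v d = C
    · rw [dualFunction_of_eq c p₀ C ht hu hv] at h5
      refine (hx.isDualOptimal_iff hC).2 ⟨⟨h1, fun d => ⟨Finset.sum_nonneg fun y hy =>
        h1 d y (Finset.ne_of_mem_erase hy), ?_⟩⟩, (hcancel h5).symm⟩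
      linarith [hv d, h2 d]
    · rw [dualFunction_of_ne c p₀ C ht hu hv] at h5
      exact absurd h5 (EReal.add_ne_bot_iff.2 ⟨variationalBound_ne_bot c, EReal.coe_ne_bot _⟩)
  · intro hμ
    obtain ⟨hf, heq⟩ := (hx.isDualOptimal_iff hC).1 hμ
    have hv : ∀ d, multSum c μ d + (C - multSum c μ d) = C := fun d => by ring
    have hv0 : ∀ d, 0 ≤ C - multSum c μ d := fun d => by linarith [(hf.2 d).2]
    have hm0 : ∀ d, ∀ y ∈ Finset.univ.erase (c.label d),
        0 ≤ μ d y * (expectedMargin c x.topic x.qη d y + x.ξ d - 1) := fun d y hy =>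
      mul_nonneg (hf.1 d y (Finset.ne_of_mem_erase hy))
        (by linarith [hx.1.margin d y (Finset.ne_of_mem_erase hy)])
    have hvξ : ∀ d, 0 ≤ (C - multSum c μ d) * x.ξ d := fun d =>
      mul_nonneg (hv0 d) (hx.1.slack_nonneg d)
    have hlag' : lagrangian c p₀ C x μ (fun d => C - multSum c μ d) =
        variationalBound c x.topic +
          (((klDiv x.qη p₀).toReal + C * ∑ d, x.ξ d : ℝ) : EReal) := by
      lift variationalBound c x.topic to ℝ using ⟨hu, variationalBound_ne_bot c⟩ with u hu'
      have h := lagrangian_eq c p₀ C hu'.symm hkl x.ξ μ (fun d => C - multSum c μ d)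
      rw [hx.marginLagrangian_eq hC hμ] at h
      simp only [sub_self, zero_mul, Finset.sum_const_zero, add_zero, EReal.coe_add u] at h
      exact h
    -- Comparison of the definition of the Lagrangian with its value `hlag'`: the nonnegative
    -- products add up to zero, so each of them vanishes.
    have hsum : ∑ d, (C - multSum c μ d) * x.ξ d + ∑ d, ∑ y ∈ Finset.univ.erase (c.label d),
        μ d y * (expectedMargin c x.topic x.qη d y + x.ξ d - 1) = 0 := by
      have := hcancel ((hlag _).symm.trans hlag')
      rw [EReal.coe_eq_coe_iff] at this
      linarith
    have hnonneg := Finset.sum_nonneg fun d (_ : d ∈ Finset.univ) => Finset.sum_nonneg (hm0 d)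
    have hnonneg' := Finset.sum_nonneg fun d (_ : d ∈ Finset.univ) => hvξ d
    refine ⟨_, hf.1, hv0, fun d y hy => ?_, fun d => ?_, ?_⟩
    · have h1 := (Finset.sum_eq_zero_iff_of_nonneg fun d _ => Finset.sum_nonneg (hm0 d)).1
        (by linarith) d (Finset.mem_univ d)
      exact (Finset.sum_eq_zero_iff_of_nonneg (hm0 d)).1 h1 y
        (Finset.mem_erase.2 ⟨hy, Finset.mem_univ y⟩)
    · exact (Finset.sum_eq_zero_iff_of_nonneg fun d _ => hvξ d).1 (by linarith) d
        (Finset.mem_univ d)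
    · rw [hlag', dualFunction_of_eq c p₀ C ht hu hv, heq]

end MedLDA

/-! ### Exponential tilts of the standard normal distribution. -/

namespace ProbabilityTheory

variable {ι : Type*} [Fintype ι]

/-- The Laplace transform of the standard normal distribution at a complex vector. -/
lemma integral_cexp_sum_stdGaussian (w : ι → ℂ) :
    ∫ η : EuclideanSpace ℝ ι, Complex.exp (∑ i, w i * η i) ∂(stdGaussian (EuclideanSpace ℝ ι)) =
      Complex.exp (∑ i, w i ^ 2 / 2) := by
  rw [← map_pi_eq_stdGaussian, integral_map (Measurable.aemeasurable (by fun_prop))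
    (Measurable.aestronglyMeasurable (by fun_prop))]
  simp_rw [Complex.exp_sum]
  rw [integral_fintype_prod_eq_prod (f := fun i (x : ℝ) => Complex.exp (w i * x))]
  refine Finset.prod_congr rfl fun i _ => ?_
  have h := complexMGF_id_gaussianReal (μ := 0) (v := 1) (w i)
  rw [complexMGF] at h
  simpa using h

/-- The complex vector `l + i s` handles tilt and Fourier transform together: `s = 0` gives the
normalizer, general `s` the characteristic function of the tilt. -/
lemma integral_cexp_inner_add_stdGaussian (l s : EuclideanSpace ℝ ι) :
    ∫ η : EuclideanSpace ℝ ι, Complex.exp ((inner ℝ η l : ℝ) + (inner ℝ η s : ℝ) * Complex.I)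
      ∂(stdGaussian (EuclideanSpace ℝ ι)) =
      Complex.exp ((‖l‖ ^ 2 / 2 : ℝ) + ((inner ℝ s l : ℝ) * Complex.I - (‖s‖ ^ 2 / 2 : ℝ))) := by
  have h := integral_cexp_sum_stdGaussian fun i => (l i : ℂ) + s i * Complex.I
  convert! h using 3
  · simp [PiLp.inner_apply, Finset.sum_add_distrib, add_mul, Finset.sum_mul, mul_right_comm]
  · have hsq : ∀ i, ((l i : ℂ) + s i * Complex.I) ^ 2 / 2 =
        (l i : ℂ) ^ 2 / 2 + ((l i * s i : ℂ) * Complex.I - (s i : ℂ) ^ 2 / 2) := fun i => by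
      linear_combination (s i : ℂ) ^ 2 / 2 * Complex.I_sq
    simp [hsq, EuclideanSpace.real_norm_sq_eq, PiLp.inner_apply, Finset.sum_add_distrib,
      Finset.sum_sub_distrib, Finset.sum_mul, Finset.sum_div]

lemma integrable_exp_inner_stdGaussian (l : EuclideanSpace ℝ ι) :
    Integrable (fun η => Real.exp (inner ℝ η l)) (stdGaussian (EuclideanSpace ℝ ι)) := by
  have h := integral_cexp_inner_add_stdGaussian l 0
  have hint : Integrable (fun η : EuclideanSpace ℝ ι =>
      Complex.exp ((inner ℝ η l : ℝ) + (inner ℝ η (0 : EuclideanSpace ℝ ι) : ℝ) * Complex.I))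
      (stdGaussian (EuclideanSpace ℝ ι)) := by
    -- The integral of a non-integrable function is `0` by convention, but here it is an
    -- exponential.
    by_contra hn
    rw [integral_undef hn] at h
    exact Complex.exp_ne_zero _ h.symm
  refine hint.norm.congr (ae_of_all _ fun η => ?_)
  simp [Complex.norm_exp]

lemma integral_exp_inner_stdGaussian (l : EuclideanSpace ℝ ι) :
    ∫ η, Real.exp (inner ℝ η l) ∂(stdGaussian (EuclideanSpace ℝ ι)) = Real.exp (‖l‖ ^ 2 / 2) := by
  have h := integral_cexp_inner_add_stdGaussian l 0
  simp only [inner_zero_right, inner_zero_left, Complex.ofReal_zero, zero_mul, add_zero, norm_zero,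
    ne_eq, OfNat.ofNat_ne_zero, not_false_eq_true, zero_pow, zero_div, sub_zero,
    ← Complex.ofReal_exp] at h
  rw [integral_complex_ofReal] at h
  exact_mod_cast h

/-- Characteristic functions agree: that of the tilt is the Laplace transform at `l + i s` divided
by its value at `l`. -/
lemma stdGaussian_tilted [DecidableEq ι] (l : EuclideanSpace ℝ ι) :
    (stdGaussian (EuclideanSpace ℝ ι)).tilted (fun η => inner ℝ η l) =
      multivariateGaussian l 1 := by
  have := isProbabilityMeasure_tilted (integrable_exp_inner_stdGaussian l)
  refine Measure.ext_of_charFun (funext fun s => ?_)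
  rw [charFun_multivariateGaussian Matrix.PosSemidef.one, charFun_apply, integral_tilted,
    integral_exp_inner_stdGaussian]
  have h := integral_cexp_inner_add_stdGaussian l s
  rw [Complex.exp_add] at h
  have hsq : s.ofLp ⬝ᵥ (1 : Matrix ι ι ℝ).mulVec s.ofLp = ‖s‖ ^ 2 := by
    rw [Matrix.one_mulVec, EuclideanSpace.real_norm_sq_eq]
    simp [dotProduct, sq]
  rw [hsq]
  have hfun : ∀ η : EuclideanSpace ℝ ι,
      (Real.exp (inner ℝ η l) / Real.exp (‖l‖ ^ 2 / 2)) • Complex.exp ((inner ℝ η s : ℝ) * Complex.I)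
      = (Complex.exp (‖l‖ ^ 2 / 2 : ℝ))⁻¹ *
        Complex.exp ((inner ℝ η l : ℝ) + (inner ℝ η s : ℝ) * Complex.I) := fun η => by
    rw [Complex.real_smul, Complex.ofReal_div, Complex.ofReal_exp, Complex.ofReal_exp,
      Complex.exp_add]
    ring
  simp_rw [hfun]
  rw [integral_const_mul, h, inv_mul_cancel_left₀ (Complex.exp_ne_zero _)]
  push_cast
  rfl

end ProbabilityTheory

/-! ### The multi-class SVM and the `η`-step with a standard normal prior. -/

namespace MedLDA

variable {D N V M K : ℕ} {c : Corpus D N V M} {t : TopicVars D N V K} {C : ℝ}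
  {μ : Fin D → Fin M → ℝ}

lemma tilt_stdGaussian (l : Weights M K) :
    tilt (stdGaussian (Weights M K)) l = multivariateGaussian l 1 := by
  rw [tilt_eq_tilted _ (integrable_exp_inner_stdGaussian l), stdGaussian_tilted]

lemma dualObjective_stdGaussian (μ : Fin D → Fin M → ℝ) :
    dualObjective c (stdGaussian (Weights M K)) t μ = (svmDualObjective c t μ : EReal) := by
  rw [dualObjective, log_partition_eq _ (integrable_exp_inner_stdGaussian _),
    integral_exp_inner_stdGaussian, Real.log_exp, svmDualObjective, EReal.coe_add, ← EReal.coe_neg]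
  congr 2
  ring

lemma isDualOptimal_stdGaussian_iff :
    IsDualOptimal c (stdGaussian (Weights M K)) C t μ ↔ IsSvmDualOptimal c C t μ := by
  simp only [IsDualOptimal, IsSvmDualOptimal, dualObjective_stdGaussian, EReal.coe_le_coe_iff]

/-- Completing the square in `w` shows the minimizer `w = λ` and leaves the dual objective. -/
lemma svmLagrangian_eq (w : Weights M K) (ξ : Fin D → ℝ) (μ : Fin D → Fin M → ℝ)
    (v : Fin D → ℝ) : svmLagrangian c C t w ξ μ v =
      1 / 2 * ‖w - lam c t μ‖ ^ 2 + svmDualObjective c t μ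
        + ∑ d, (C - multSum c μ d - v d) * ξ d := by
  have h : ∑ d, ∑ y ∈ Finset.univ.erase (c.label d),
        μ d y * (inner ℝ w (meanDeltaF c t d y) + ξ d - 1) =
      inner ℝ w (lam c t μ) + ∑ d, multSum c μ d * ξ d - ∑ d, multSum c μ d := by
    rw [inner_lam, ← Finset.sum_add_distrib, ← Finset.sum_sub_distrib]
    refine Finset.sum_congr rfl fun d _ => ?_
    rw [multSum, Finset.sum_mul, ← Finset.sum_add_distrib, ← Finset.sum_sub_distrib]
    exact Finset.sum_congr rfl fun y _ => by ring
  rw [svmLagrangian, svmDualObjective, h, norm_sub_sq_real]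
  simp only [sub_mul, Finset.sum_sub_distrib, Finset.mul_sum]
  ring

lemma iInf_svmLagrangian_of_eq {v : Fin D → ℝ} (h : ∀ d, multSum c μ d + v d = C) :
    (⨅ (w : Weights M K) (ξ : Fin D → ℝ), ((svmLagrangian c C t w ξ μ v : ℝ) : EReal)) =
      ((svmDualObjective c t μ : ℝ) : EReal) := by
  have h0 : ∀ (w : Weights M K) (ξ : Fin D → ℝ), svmLagrangian c C t w ξ μ v =
      1 / 2 * ‖w - lam c t μ‖ ^ 2 + svmDualObjective c t μ := fun w ξ => by
    rw [svmLagrangian_eq, Finset.sum_eq_zero fun d _ => by rw [← h d]; ring, add_zero]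
  apply le_antisymm
  · refine (iInf₂_le (lam c t μ) 0).trans ?_
    rw [h0]
    simp
  · refine le_iInf₂ fun w ξ => EReal.coe_le_coe_iff.2 ?_
    rw [h0]
    linarith [sq_nonneg ‖w - lam c t μ‖]

lemma iInf_svmLagrangian_of_ne {v : Fin D → ℝ} (h : ¬ ∀ d, multSum c μ d + v d = C) :
    (⨅ (w : Weights M K) (ξ : Fin D → ℝ), ((svmLagrangian c C t w ξ μ v : ℝ) : EReal)) = ⊥ := by
  obtain ⟨d, hd⟩ := not_forall.1 h
  have hd' : C - multSum c μ d - v d ≠ 0 := fun h0 => hd (by linarith)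
  refine (EReal.eq_bot_iff_forall_lt _).2 fun r => ?_
  -- At `w = λ` the square vanishes, and this slack makes the Lagrangian `r - 1`.
  refine (iInf₂_le (lam c t μ) (Pi.single d
    ((r - 1 - svmDualObjective c t μ) / (C - multSum c μ d - v d)))).trans_lt ?_
  rw [svmLagrangian_eq, EReal.coe_lt_coe_iff,
    Finset.sum_eq_single_of_mem d (Finset.mem_univ d) fun d' _ hne => by
      rw [Pi.single_eq_of_ne hne, mul_zero], Pi.single_eq_same, mul_div_cancel₀ _ hd', sub_self,
    norm_zero]
  linarith

/-- The first-order optimality condition for the dual of the support vector machine. -/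
lemma IsSvmDualOptimal.first_order (hμ : IsSvmDualOptimal c C t μ) {ν : Fin D → Fin M → ℝ}
    (hν : DualFeasible c C ν) :
    ∑ d, multSum c ν d - inner ℝ (lam c t μ) (lam c t ν) ≤
      ∑ d, multSum c μ d - inner ℝ (lam c t μ) (lam c t μ) := by
  by_contra! hlt
  set A := ∑ d, multSum c ν d - inner ℝ (lam c t μ) (lam c t ν) -
    (∑ d, multSum c μ d - inner ℝ (lam c t μ) (lam c t μ)) with hA
  set B := ‖lam c t ν - lam c t μ‖ ^ 2 with hB
  have hApos : 0 < A := sub_pos.2 hlt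
  have hB0 : 0 ≤ B := sq_nonneg _
  -- The left side is the change of the objective from `μ` to the point `(1 - s) μ + s ν` of the
  -- segment.
  have key : ∀ s : ℝ, 0 ≤ s → s ≤ 1 → s * A - s ^ 2 / 2 * B ≤ 0 := by
    intro s h0 h1
    have h := hμ.2 _ (convex_dualFeasible hμ.1 hν (sub_nonneg.2 h1) h0 (by ring))
    simp only [svmDualObjective, lam_convexCombination, multSum_convexCombination,
      Finset.sum_add_distrib, ← Finset.mul_sum] at h
    have he : (1 - s) • lam c t μ + s • lam c t ν = lam c t μ + s • (lam c t ν - lam c t μ) := by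
      module
    rw [he, norm_add_sq_real, norm_smul, mul_pow, Real.norm_eq_abs, sq_abs, ← hB,
      real_inner_smul_right, inner_sub_right] at h
    linear_combination h + s * hA
  -- Here `s (B + 1) ≤ A`, so the linear term exceeds the quadratic one; `B + 1` avoids division by
  -- zero.
  have hs : 0 < min 1 (A / (B + 1)) := lt_min one_pos (by positivity)
  have hsB : min 1 (A / (B + 1)) * (B + 1) ≤ A :=
    (le_div_iff₀ (by positivity)).1 (min_le_right _ _)
  nlinarith [key _ hs.le (min_le_left _ _)]

lemma expectedMargin_multivariateGaussian (ht : t.Valid) (l : Weights M K) {d : Fin D} {y : Fin M}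
    (hy : y ≠ c.label d) :
    expectedMargin c t (multivariateGaussian l 1) d y = inner ℝ l (meanDeltaF c t d y) := by
  rw [(admissible_of_integrable c ht IsGaussian.integrable_id).expectedMargin_eq ht hy]
  simp_rw [real_inner_comm (meanDeltaF c t d y)]
  rw [integral_inner IsGaussian.integrable_fun_id, integral_id_multivariateGaussian]

/-- The normal distribution given by a solution of the dual of the support vector machine is optimal
for the `η`-step. -/
lemma IsSvmDualOptimal.exists_isEtaOptimal (hC : 0 ≤ C) (ht : t.Valid)
    (hu : variationalBound c t ≠ ⊤) (hμ : IsSvmDualOptimal c C t μ) :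
    ∃ ξ, IsEtaOptimal c (stdGaussian (Weights M K)) C
      ⟨t, multivariateGaussian (lam c t μ) 1, ξ⟩ := by
  have hq : Admissible c t (multivariateGaussian (lam c t μ) 1) :=
    admissible_of_integrable c ht IsGaussian.integrable_id
  obtain ⟨hkl, heq⟩ := klDiv_tilt (stdGaussian (Weights M K))
    (integrable_exp_inner_stdGaussian (lam c t μ))
    (by rw [tilt_stdGaussian]; exact hq.integrable_inner_lam ht μ)
  rw [tilt_stdGaussian] at hkl heq
  obtain ⟨ξ, ν, hν, hξ, hg, hsum⟩ := exists_slack_and_multipliers (c := c) hC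
    fun d y => 1 - expectedMargin c t (multivariateGaussian (lam c t μ) 1) d y
  have hfeas : Feasible c ⟨t, multivariateGaussian (lam c t μ) 1, ξ⟩ :=
    ⟨ht, hq, fun d y hy => by linarith [hg d y hy], hξ⟩
  -- Since `N(λ, I)` has mean `λ`, the penalty is the linear functional of `first_order`.
  have hmargin : ∀ ν : Fin D → Fin M → ℝ, ∑ d, ∑ y ∈ Finset.univ.erase (c.label d),
      ν d y * (1 - expectedMargin c t (multivariateGaussian (lam c t μ) 1) d y) =
      ∑ d, multSum c ν d - inner ℝ (lam c t μ) (lam c t ν) := by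
    intro ν
    rw [inner_lam, ← Finset.sum_sub_distrib]
    refine Finset.sum_congr rfl fun d _ => ?_
    rw [multSum, ← Finset.sum_sub_distrib]
    refine Finset.sum_congr rfl fun y hy => ?_
    rw [expectedMargin_multivariateGaussian ht _ (Finset.ne_of_mem_erase hy)]
    ring
  -- By `first_order`, `μ` does at least as well as the `ν` that attains the optimal slacks.
  have hle : (klDiv (multivariateGaussian (lam c t μ) 1) (stdGaussian (Weights M K))).toReal +
      C * ∑ d, ξ d ≤ marginLagrangian c (stdGaussian (Weights M K)) t
        (multivariateGaussian (lam c t μ) 1) μ := by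
    rw [marginLagrangian, ← hsum, hmargin, hmargin]
    exact add_le_add_right (hμ.first_order hν.1) _
  -- The tilt attains the Donsker-Varadhan bound; with `hle`, the primal value is at most the dual
  -- objective, and weak duality gives optimality.
  have hdual : (marginLagrangian c (stdGaussian (Weights M K)) t
      (multivariateGaussian (lam c t μ) 1) μ : EReal) =
      dualObjective c (stdGaussian (Weights M K)) t μ := by
    rw [hq.marginLagrangian_eq c ht, EReal.coe_add, heq, dualObjective]
  lift variationalBound c t to ℝ using ⟨hu, variationalBound_ne_bot c⟩ with u hu'
  refine ⟨ξ, hfeas, ?_, ?_⟩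
  · rw [objective_eq hu'.symm hkl]
    exact EReal.coe_ne_top _
  · rintro ⟨t', q', ξ'⟩ hf' heq'
    obtain rfl : t = t' := heq'.symm
    by_cases htop : objective c (stdGaussian (Weights M K)) C ⟨t, q', ξ'⟩ = ⊤
    · exact htop ▸ le_top
    · have hkl' := (variationalBound_ne_top_of_objective htop).2
      rw [objective_eq hu'.symm hkl, objective_eq hu'.symm hkl', EReal.coe_le_coe_iff]
      have h := hf'.dualObjective_le hkl' hμ.1
      rw [← hdual, EReal.coe_le_coe_iff] at h
      linarith

end MedLDA

open Classical in
theorem corollary4 {D N V M K : ℕ} (c : MedLDA.Corpus D N V M)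
    (p₀ : Measure (MedLDA.Weights M K)) [IsProbabilityMeasure p₀] (C : ℝ) (hC : 0 < C) :
    -- `D3` is the Lagrange dual of the problem in `q(η)` and `ξ`, and it has a solution
    (∀ t : MedLDA.TopicVars D N V K, t.Valid →
      (MedLDA.variationalBound c t ≠ ⊤ → ∀ (μ : Fin D → Fin M → ℝ) (v : Fin D → ℝ),
        MedLDA.dualFunction c p₀ C t μ v =
          if ∀ d, MedLDA.multSum c μ d + v d = C then
            MedLDA.variationalBound c t + MedLDA.dualObjective c p₀ t μ
          else ⊥) ∧
      ∃ μ, MedLDA.IsDualOptimal c p₀ C t μ) ∧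
    -- the form of the optimum `q(η)`, and the multipliers
    (∀ x : MedLDA.Vars D N V M K,
      (MedLDA.IsOptimal c p₀ C x ∨ MedLDA.IsEtaOptimal c p₀ C x) → ∀ μ : Fin D → Fin M → ℝ,
        ((∃ v, MedLDA.IsMultiplier c p₀ C x μ v) ↔ MedLDA.IsDualOptimal c p₀ C x.topic μ) ∧
        (MedLDA.IsDualOptimal c p₀ C x.topic μ →
          MedLDA.partition p₀ (MedLDA.lam c x.topic μ) ≠ ⊤ ∧
          x.qη = MedLDA.tilt p₀ (MedLDA.lam c x.topic μ))) ∧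
    -- the standard normal prior
    (p₀ = multivariateGaussian 0 1 → ∀ t : MedLDA.TopicVars D N V K, t.Valid →
      (∀ μ : Fin D → Fin M → ℝ,
        MedLDA.tilt p₀ (MedLDA.lam c t μ) = multivariateGaussian (MedLDA.lam c t μ) 1 ∧
        MedLDA.dualObjective c p₀ t μ = ((MedLDA.svmDualObjective c t μ : ℝ) : EReal) ∧
        (MedLDA.IsDualOptimal c p₀ C t μ ↔ MedLDA.IsSvmDualOptimal c C t μ) ∧
        (∀ v : Fin D → ℝ,
          (⨅ (w : MedLDA.Weights M K) (ξ : Fin D → ℝ),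
            ((MedLDA.svmLagrangian c C t w ξ μ v : ℝ) : EReal)) =
          if ∀ d, MedLDA.multSum c μ d + v d = C then
            ((MedLDA.svmDualObjective c t μ : ℝ) : EReal)
          else ⊥) ∧
        (MedLDA.variationalBound c t ≠ ⊤ → MedLDA.IsSvmDualOptimal c C t μ →
          ∃ ξ, MedLDA.IsEtaOptimal c p₀ C
            ⟨t, multivariateGaussian (MedLDA.lam c t μ) 1, ξ⟩)) ∧
      ∀ x : MedLDA.Vars D N V M K,
        (MedLDA.IsOptimal c p₀ C x ∨ MedLDA.IsEtaOptimal c p₀ C x) → x.topic = t →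
        ∀ μ : Fin D → Fin M → ℝ, MedLDA.IsSvmDualOptimal c C t μ →
          x.qη = multivariateGaussian (MedLDA.lam c t μ) 1) := by
  have hC' : 0 ≤ C := hC.le
  have heta : ∀ x : MedLDA.Vars D N V M K,
      (MedLDA.IsOptimal c p₀ C x ∨ MedLDA.IsEtaOptimal c p₀ C x) →
        MedLDA.IsEtaOptimal c p₀ C x := fun x hx => hx.elim (fun h => h.isEtaOptimal) id
  refine ⟨fun t ht => ⟨fun hu μ v => ?_, MedLDA.exists_isDualOptimal p₀ hC' ht⟩,
    fun x hx μ => ⟨(heta x hx).exists_isMultiplier_iff hC', fun hμ => (heta x hx).eq_tilt hC' hμ⟩,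
    ?_⟩
  · split_ifs with h
    · exact MedLDA.dualFunction_of_eq c p₀ C ht hu h
    · exact MedLDA.dualFunction_of_ne c p₀ C ht hu h
  · intro hp t ht
    rw [multivariateGaussian_zero_one] at hp
    subst hp
    refine ⟨fun μ => ⟨MedLDA.tilt_stdGaussian _, MedLDA.dualObjective_stdGaussian μ,
      MedLDA.isDualOptimal_stdGaussian_iff, fun v => ?_,
      fun hu hμ => hμ.exists_isEtaOptimal hC' ht hu⟩, ?_⟩
    · split_ifs with h
      · exact MedLDA.iInf_svmLagrangian_of_eq h
      · exact MedLDA.iInf_svmLagrangian_of_ne h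
    · rintro x hx rfl μ hμ
      rw [((heta x hx).eq_tilt hC' (MedLDA.isDualOptimal_stdGaussian_iff.2 hμ)).2,
        MedLDA.tilt_stdGaussian]
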